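/- Let $\Omega\subset\mathbb{R}^2$ be a bounded open set, let $V\subset\Omega$, and let $\Gamma=\Omega\cap\partial V$ be the boundary of $V$ in $\Omega$. Suppose that $\Gamma$ is nonempty and regular in the following sense: (a) every point of $\overline\Gamma$ has an open neighborhood $U$ in which, for suitable orthonormal coordinates $(y_1,y_2)$ and a $C^1$ function $h$, all points of $U\cap\Omega$ with $y_2<h(y_1)$ belong to $V$ and all points of $U\cap\Omega$ with $y_2>h(y_1)$ do not belong to $V$; (b) $\mathcal{H}^1(\overline\Gamma\cap\partial\Omega)=0$, where $\mathcal H^1$ is the one-dimensional Hausdorff measure (this is automatic when $\overline\Gamma\subset\Omega$). Let $d$ be the signed distance to $\Gamma$, that is, $d(x)=\mathrm{dist}(x,\Gamma)$ for $x\in V$ and $d(x)=-\mathrm{dist}(x,\Gamma)$ for $x\notin V$. For $\varepsilon>0$ let $$p_\varepsilon(x)=\sigma\!\left(\frac{d(x)}{3\varepsilon}\right),\qquad \sigma(t)=\frac1{1+e^{-t}} .$$ For $p:\Omega\to\mathbb{R}$ let $$E_\varepsilon[p]=\int_\Omega\Big(9\varepsilon|\nabla p|^2+\frac{(p(1-p))^2}{\varepsilon}\Big)dx$$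 if $p\in H^1(\Omega)$ ($\nabla p$ being the weak gradient), and $E_\varepsilon[p]=+\infty$ otherwise. Write $\mathrm{length}(\Gamma)=\mathcal H^1(\Gamma)$ and $$\int_\Omega|D1_V|=\sup\Big\{\int_\Omega 1_V\,\nabla\!\cdot g\,dx \;:\; g\in C^1_c(\Omega;\mathbb{R}^2),\ |g|\le 1\Big\}.$$ Then, as $\varepsilon\to0^+$, $p_\varepsilon\to 1_V$ in $L^1(\Omega)$ and $$E_\varepsilon[p_\varepsilon]\;\longrightarrow\;\mathrm{length}(\Gamma)=\int_\Omega|D1_V|<\infty .$$ -/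

import Mathlib

open MeasureTheory Set Filter Topology
open scoped ENNReal ContDiff

namespace SoftMS

/-- The Euclidean plane `ℝ²`. -/
abbrev Plane : Type := EuclideanSpace ℝ (Fin 2)

/-- The divergence of a vector field on the plane. -/
noncomputable def divergence (g : Plane → Plane) (x : Plane) : ℝ :=
  ∑ i : Fin 2, (fderiv ℝ g x (EuclideanSpace.single i 1)) i

/-- The total variation `∫_Ω |Dq|`: the supremum of `∫_Ω q div g` over the `C¹` vector fields `g`
with compact support in `Ω` and values in the closed unit disk. (The field `g = 0` is admissible,
so the supremum is nonnegative and truncating negative values at `0` does not change it.) -/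
noncomputable def totalVariation (Ω : Set Plane) (q : Plane → ℝ) : ℝ≥0∞ :=
  ⨆ (g : Plane → Plane) (_ : ContDiff ℝ 1 g ∧ HasCompactSupport g ∧ tsupport g ⊆ Ω ∧
      ∀ x, ‖g x‖ ≤ 1),
    ENNReal.ofReal (∫ x in Ω, q x * divergence g x)

/-- `p ∈ H¹(Ω)` with weak gradient `G`: both are square integrable on `Ω`, and
`∫_Ω p ∂ᵥφ = - ∫_Ω ⟨G, v⟩ φ` for every direction `v` and every smooth test function `φ` with
compact support in `Ω`. -/
structure IsH1WithGradient (Ω : Set Plane) (p : Plane → ℝ) (G : Plane → Plane) : Prop where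
  memLp_fun : MemLp p 2 (volume.restrict Ω)
  memLp_grad : MemLp G 2 (volume.restrict Ω)
  integral_eq : ∀ φ : Plane → ℝ, ContDiff ℝ ∞ φ → HasCompactSupport φ → tsupport φ ⊆ Ω →
    ∀ v : Plane, ∫ x in Ω, p x * fderiv ℝ φ x v = - ∫ x in Ω, inner ℝ (G x) v * φ x

/-- The Modica-Mortola energy `E_ε[p] = ∫_Ω (9 ε |∇p|² + (p (1 - p))² / ε)` with the weak gradient
`∇p` if `p ∈ H¹(Ω)`, and `E_ε[p] = +∞` otherwise. (The weak gradient is unique almost everywhere on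
the open set `Ω`, so the infimum is over copies of one value; it is `+∞` if there is no weak
gradient.) -/
noncomputable def energy (Ω : Set Plane) (ε : ℝ) (p : Plane → ℝ) : ℝ≥0∞ :=
  ⨅ (G : Plane → Plane) (_ : IsH1WithGradient Ω p G),
    ∫⁻ x in Ω, ENNReal.ofReal (9 * ε * ‖G x‖ ^ 2 + (p x * (1 - p x)) ^ 2 / ε)

/-- The hard boundary `Γ = ∂V` in the domain `Ω`: the topological boundary of `V` relative to the
open set `Ω`. -/
def hardBoundary (Ω V : Set Plane) : Set Plane := Ω ∩ frontier V

open Classical in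
/-- The signed distance to the hard boundary, positive in `V` and negative outside. -/
noncomputable def signedDistance (Ω V : Set Plane) (x : Plane) : ℝ :=
  if x ∈ V then Metric.infDist x (hardBoundary Ω V) else - Metric.infDist x (hardBoundary Ω V)

/-- The sigmoidal transition `p_ε = σ(d / (3 ε))` across the hard boundary, where
`σ(t) = 1 / (1 + exp (-t))` and `d` is the signed distance. -/
noncomputable def sigmoidProfile (Ω V : Set Plane) (ε : ℝ) (x : Plane) : ℝ :=
  Real.sigmoid (signedDistance Ω V x / (3 * ε))

/-- The hard boundary `Γ` of `V` in `Ω` is regular (of class `C¹`, up to the boundary of `Ω`).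
Near each point of the closure of `Γ`, in suitable orthonormal coordinates, there is a `C¹` function
`h` such that the points of `Ω` below the graph of `h` are in `V` and those above it are not.
(Consequently `Γ` is the part in `Ω` of the graph.) Moreover `Γ` reaches the boundary of `Ω`
only in a set of length zero. -/
structure HasRegularBoundary (Ω V : Set Plane) : Prop where
  exists_graph : ∀ x ∈ closure (hardBoundary Ω V), ∃ U : Set Plane, IsOpen U ∧ x ∈ U ∧
    ∃ (A : Plane ≃ₗᵢ[ℝ] Plane) (h : ℝ → ℝ), ContDiff ℝ 1 h ∧
      ∀ y ∈ U ∩ Ω, ((A y) 1 < h ((A y) 0) → y ∈ V) ∧ (h ((A y) 0) < (A y) 1 → y ∉ V)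
  null_contact : μH[1] (closure (hardBoundary Ω V) ∩ frontier Ω) = 0

end SoftMS

/-!
Write `K` for the closure of the hard boundary `Γ`. The three quantities are compared in a circle:
`TV ≤ liminf E_ε ≤ limsup E_ε ≤ μH[1] K = μH[1] Γ ≤ TV`.

The geometric input is `HasRegularBoundary.exists_isFlatChart`: a `C¹` graph, rotated so that its
tangent at a point is horizontal, is near this point the graph of a function with Lipschitz constant
at most a prescribed `δ`. Everything else uses only Lipschitz graphs of small slope, whose length
differs from that of the projection to the axis by a factor of at most `1 + δ`.

* `limsup E_ε ≤ μH[1] K`. The signed distance `d` is 1-Lipschitz on balls inside `Ω`, since a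
  segment in `Ω` from `V` to its complement crosses `Γ`. Hence the gradient term of the energy is at
  most the potential term, and `E_ε ≤ ∫_Ω F (dist / (3 ε)) / (3 ε)` with `F = 6 σ' ²`. By the layer-cake
  formula this is a weighted average of the quotients `vol {dist < r} / (2 r)`, with `r` of order
  `ε`. The upper Minkowski content of `K` is at most `μH[1] K`
  (`eventually_volume_thickening_le`): cut `K` into compact pieces inside flat charts, along spheres
  that carry no length, and enclose the tube around each piece between two translates of the graph.
* `TV ≤ liminf E_ε`. With `Q u = 3 u² - 2 u³`, Young's inequality bounds `|∇ (Q ∘ p)|` by the density of the energy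
  (`ofReal_setIntegral_le_energy`), and `Q ∘ p_ε → 1_V`. This uses that every weak gradient of
  `p_ε` is its almost everywhere defined gradient (`IsH1WithGradient.ae_eq_gradient`), and
  integration by parts for functions that are locally Lipschitz in `Ω`
  (`setIntegral_mul_divergence`).
* `μH[1] Γ ≤ TV`. In a flat chart, Fubini's theorem gives the divergence theorem for fields `φ • w`
  of constant vertical direction `w` (`IsFlatChart.setIntegral_fderiv`). A partition of unity on
  a compact part of `Γ` glues these fields to an admissible one (`hausdorffMeasure_isCompact_le`).

The contact condition enters only through `μH[1] K = μH[1] Γ`.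
-/

namespace SoftMS

open scoped NNReal

/-! ### Flat graph coordinates -/

/-- The rotation of the plane that takes the unit vector `(1, a) / √(1 + a²)` to the first
coordinate vector. -/
theorem exists_rotation (a : ℝ) : ∃ R : Plane ≃ₗᵢ[ℝ] Plane, ∀ y : Plane,
    (R y) 0 = (y 0 + a * y 1) / √(1 + a ^ 2) ∧ (R y) 1 = (y 1 - a * y 0) / √(1 + a ^ 2) := by
  have hc : 0 < √(1 + a ^ 2) := Real.sqrt_pos.2 (by positivity)
  have hc2 : √(1 + a ^ 2) ^ 2 = 1 + a ^ 2 := Real.sq_sqrt (by positivity)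
  set c := √(1 + a ^ 2)
  let f : Plane →ₗ[ℝ] Plane :=
    { toFun := fun y => !₂[(y 0 + a * y 1) / c, (y 1 - a * y 0) / c]
      map_add' := by
        intro x y
        ext i
        fin_cases i <;> simp <;> ring
      map_smul' := by
        intro r x
        ext i
        fin_cases i <;> simp <;> ring }
  let g : Plane →ₗᵢ[ℝ] Plane :=
    { f with
      norm_map' := by
        intro y
        have : ‖f y‖ ^ 2 = ‖y‖ ^ 2 := by
          simp only [EuclideanSpace.norm_sq_eq, Fin.sum_univ_two, Real.norm_eq_abs, sq_abs]
          change ((y 0 + a * y 1) / c) ^ 2 + ((y 1 - a * y 0) / c) ^ 2 = _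
          rw [div_pow, div_pow, hc2]
          field_simp
          ring
        exact (sq_eq_sq₀ (norm_nonneg _) (norm_nonneg _)).1 this }
  refine ⟨g.toLinearIsometryEquiv rfl, fun y => ?_⟩
  rw [LinearIsometry.toLinearIsometryEquiv_apply]
  exact ⟨rfl, rfl⟩

/-- The implicit description of a graph after the rotation by the slope `a`: the graph of
`s ↦ a s + w s`, with `w` of small Lipschitz constant, becomes the graph of a function of small
Lipschitz constant. -/
theorem exists_lipschitz_rotated_graph (a : ℝ) {η : ℝ≥0} (hη : η ≤ 1) {w : ℝ → ℝ}
    (hw : LipschitzWith η w) : ∃ k : ℝ → ℝ, LipschitzWith (2 * η) k ∧ ∀ s t : ℝ,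
      (t < k s → √(1 + a ^ 2) * t < w ((s - a * t) / √(1 + a ^ 2))) ∧
      (k s < t → w ((s - a * t) / √(1 + a ^ 2)) < √(1 + a ^ 2) * t) := by
  have hc : 1 ≤ √(1 + a ^ 2) := Real.one_le_sqrt.2 (by nlinarith [sq_nonneg a])
  have hc2 : √(1 + a ^ 2) ^ 2 = 1 + a ^ 2 := Real.sq_sqrt (by positivity)
  set c := √(1 + a ^ 2)
  have hη' : (η : ℝ) ≤ 1 := by exact_mod_cast hη
  have hη0 : (0 : ℝ) ≤ η := η.2
  have hw' : ∀ x y, |w x - w y| ≤ η * |x - y| := fun x y => by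
    simpa [Real.dist_eq] using hw.dist_le_mul x y
  have hac : |a| ≤ c ^ 2 / 2 := by
    rw [hc2]
    rcases abs_cases a with h | h <;> nlinarith [sq_nonneg (a - 1), sq_nonneg (a + 1)]
  -- the variation of the argument of `w` along the two directions
  have key : ∀ s₁ s₂ t₁ t₂ : ℝ, |w ((s₁ - a * t₁) / c) - w ((s₂ - a * t₂) / c)| ≤
      c * (η * |s₁ - s₂| + η / 2 * |t₁ - t₂|) := by
    intro s₁ s₂ t₁ t₂
    have e : (s₁ - a * t₁) / c - (s₂ - a * t₂) / c = ((s₁ - s₂) - a * (t₁ - t₂)) / c := by ring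
    have h1 : |(s₁ - a * t₁) / c - (s₂ - a * t₂) / c| ≤ c * (|s₁ - s₂| + |t₁ - t₂| / 2) := by
      rw [e, abs_div, abs_of_pos (by linarith : 0 < c), div_le_iff₀ (by linarith)]
      calc |(s₁ - s₂) - a * (t₁ - t₂)| ≤ |s₁ - s₂| + |a * (t₁ - t₂)| := abs_sub _ _
        _ = |s₁ - s₂| + |a| * |t₁ - t₂| := by rw [abs_mul]
        _ ≤ 1 * |s₁ - s₂| + c ^ 2 / 2 * |t₁ - t₂| := by
          gcongr
          simp
        _ ≤ c ^ 2 * |s₁ - s₂| + c ^ 2 / 2 * |t₁ - t₂| := by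
          gcongr
          nlinarith
        _ = _ := by ring
    calc _ ≤ (η : ℝ) * |(s₁ - a * t₁) / c - (s₂ - a * t₂) / c| := hw' _ _
      _ ≤ η * (c * (|s₁ - s₂| + |t₁ - t₂| / 2)) := by gcongr
      _ = _ := by ring
  -- the value of `k` at `s` is the height `t` at which the line over `s` meets the graph of
  -- `s ↦ a s + w s`; this height is the fixed point of a contraction
  have hcontr : ∀ s, ContractingWith (1 / 2) (fun t => w ((s - a * t) / c) / c) := by
    intro s
    refine ⟨by norm_num, LipschitzWith.of_dist_le_mul fun t₁ t₂ => ?_⟩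
    rw [Real.dist_eq, Real.dist_eq, ← sub_div, abs_div, abs_of_pos (by linarith : 0 < c),
      div_le_iff₀ (by linarith)]
    have := key s s t₁ t₂
    have h0 := abs_nonneg (t₁ - t₂)
    have h3 : (η : ℝ) / 2 * |t₁ - t₂| ≤ 1 / 2 * |t₁ - t₂| := by gcongr
    simp only [sub_self, abs_zero, mul_zero, zero_add] at this
    push_cast
    nlinarith [mul_le_mul_of_nonneg_left h3 (by linarith : 0 ≤ c)]
  have hfix : ∀ s, ∃ t, w ((s - a * t) / c) = c * t := fun s => by
    refine ⟨(hcontr s).fixedPoint, ?_⟩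
    have := (hcontr s).fixedPoint_isFixedPt
    have h2 : w ((s - a * (hcontr s).fixedPoint) / c) / c = (hcontr s).fixedPoint := this
    rw [div_eq_iff (by linarith)] at h2
    linarith
  choose k hk using hfix
  have hcpos : 0 < c := by linarith
  refine ⟨k, LipschitzWith.of_dist_le_mul fun s₁ s₂ => ?_, fun s t => ⟨fun h => ?_, fun h => ?_⟩⟩
  · have := key s₁ s₂ (k s₁) (k s₂)
    rw [hk, hk, ← mul_sub, abs_mul, abs_of_pos hcpos] at this
    have := le_of_mul_le_mul_left this hcpos
    rw [Real.dist_eq, Real.dist_eq]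
    push_cast
    have h3 : (η : ℝ) / 2 * |k s₁ - k s₂| ≤ 1 / 2 * |k s₁ - k s₂| := by gcongr
    linarith
  · have := key s s t (k s)
    rw [hk] at this
    have h2 := (abs_le.1 this).1
    have h3 : (η : ℝ) / 2 * |t - k s| ≤ 1 / 2 * |t - k s| := by gcongr
    have h4 := mul_le_mul_of_nonneg_left h3 hcpos.le
    have h5 : |t - k s| = k s - t := by rw [abs_sub_comm, abs_of_pos (by linarith)]
    simp only [sub_self, abs_zero, mul_zero, zero_add] at h2
    rw [h5] at h2 h4
    nlinarith [mul_pos hcpos (by linarith : 0 < k s - t)]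
  · have := key s s t (k s)
    rw [hk] at this
    have h2 := (abs_le.1 this).2
    have h3 : (η : ℝ) / 2 * |t - k s| ≤ 1 / 2 * |t - k s| := by gcongr
    have h4 := mul_le_mul_of_nonneg_left h3 hcpos.le
    have h5 : |t - k s| = t - k s := abs_of_pos (by linarith)
    simp only [sub_self, abs_zero, mul_zero, zero_add] at h2
    rw [h5] at h2 h4
    nlinarith [mul_pos hcpos (by linarith : 0 < t - k s)]

/-- On the open set `U`, in the orthonormal coordinates given by `A`, the set `V` agrees inside `Ω`
with the region below the graph of `k`, except possibly on the graph, and `k` is Lipschitz with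
constant `δ`. For small `δ` the graph is nearly a straight line. -/
structure IsFlatChart (Ω V : Set Plane) (δ : ℝ≥0) (U : Set Plane) (A : Plane ≃ₗᵢ[ℝ] Plane)
    (k : ℝ → ℝ) : Prop where
  isOpen : IsOpen U
  lipschitz : LipschitzWith δ k
  mem_of_lt : ∀ y ∈ U, y ∈ Ω → (A y) 1 < k ((A y) 0) → y ∈ V
  notMem_of_lt : ∀ y ∈ U, y ∈ Ω → k ((A y) 0) < (A y) 1 → y ∉ V

variable {Ω V U : Set Plane} {δ : ℝ≥0} {A : Plane ≃ₗᵢ[ℝ] Plane} {k : ℝ → ℝ}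

theorem IsFlatChart.mono (h : IsFlatChart Ω V δ U A k) {U' : Set Plane} (hU' : IsOpen U')
    (hsub : U' ⊆ U) : IsFlatChart Ω V δ U' A k :=
  ⟨hU', h.lipschitz, fun y hy => h.mem_of_lt y (hsub hy), fun y hy => h.notMem_of_lt y (hsub hy)⟩

@[fun_prop]
theorem continuous_coord (A : Plane ≃ₗᵢ[ℝ] Plane) (i : Fin 2) : Continuous fun y => (A y) i :=
  (EuclideanSpace.proj (𝕜 := ℝ) i).continuous.comp A.continuous

/-- A regular boundary has arbitrarily flat charts: after the rotation that makes the tangent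
horizontal, the graph has small Lipschitz constant near the point of tangency. -/
theorem HasRegularBoundary.exists_isFlatChart (hreg : HasRegularBoundary Ω V) {x : Plane}
    (hx : x ∈ closure (hardBoundary Ω V)) {δ : ℝ≥0} (hδ : 0 < δ) (hδ1 : δ ≤ 1) :
    ∃ U A k, x ∈ U ∧ IsFlatChart Ω V δ U A k := by
  obtain ⟨U, hU, hxU, A, h, hh, hV⟩ := hreg.exists_graph x hx
  -- minus its tangent at `s₀`, the function `h` has a small Lipschitz constant near `s₀`
  set s₀ := (A x) 0
  set a := deriv h s₀
  have hstrict : HasStrictDerivAt h a s₀ :=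
    hh.contDiffAt.hasStrictDerivAt one_ne_zero
  have hstrict' : HasStrictDerivAt (fun s => h s - a * s) 0 s₀ := by
    have := hstrict.sub ((hasStrictDerivAt_id s₀).const_mul a)
    rw [mul_one, sub_self] at this
    exact this
  obtain ⟨S, hS, hlip⟩ := hstrict'.hasStrictFDerivAt.exists_lipschitzOnWith_of_nnnorm_lt (δ / 2)
    (by simp [hδ])
  obtain ⟨w, hw, hweq⟩ := hlip.extend_real
  obtain ⟨k, hk, hkw⟩ := exists_lipschitz_rotated_graph a (η := δ / 2)
    ((NNReal.half_le_self δ).trans hδ1) hw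
  obtain ⟨R, hR⟩ := exists_rotation a
  have hc : 0 < √(1 + a ^ 2) := Real.sqrt_pos.2 (by positivity)
  have hc2 : √(1 + a ^ 2) ^ 2 = 1 + a ^ 2 := Real.sq_sqrt (by positivity)
  have e1 : ∀ z : Plane, √(1 + a ^ 2) * (R z) 1 = z 1 - a * z 0 := fun z => by
    rw [(hR z).2]; field_simp
  have e2 : ∀ z : Plane, ((R z) 0 - a * (R z) 1) / √(1 + a ^ 2) = z 0 := fun z => by
    rw [(hR z).1, (hR z).2]
    field_simp
    rw [hc2]
    ring
  have hk' : ∀ y : Plane, (A y) 0 ∈ interior S →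
      ((R (A y)) 1 < k ((R (A y)) 0) → (A y) 1 < h ((A y) 0)) ∧
      (k ((R (A y)) 0) < (R (A y)) 1 → h ((A y) 0) < (A y) 1) := by
    intro y hy
    have := hkw ((R (A y)) 0) ((R (A y)) 1)
    rw [e1, e2, ← hweq (interior_subset hy)] at this
    exact ⟨fun h => by linarith [this.1 h], fun h => by linarith [this.2 h]⟩
  refine ⟨U ∩ (fun y => (A y) 0) ⁻¹' interior S, A.trans R, k,
    ⟨hxU, mem_interior_iff_mem_nhds.2 hS⟩, ?_⟩
  refine ⟨hU.inter (isOpen_interior.preimage (continuous_coord A 0)), ?_, ?_, ?_⟩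
  · convert hk using 1
    rw [mul_div_cancel₀ _ two_ne_zero]
  · exact fun y hy hyΩ hlt => (hV y ⟨hy.1, hyΩ⟩).1 ((hk' y hy.2).1 hlt)
  · exact fun y hy hyΩ hlt => (hV y ⟨hy.1, hyΩ⟩).2 ((hk' y hy.2).2 hlt)

/-- The parametrization of the graph of `k` in the orthonormal coordinates given by `A`. -/
noncomputable def graphMap (A : Plane ≃ₗᵢ[ℝ] Plane) (k : ℝ → ℝ) (s : ℝ) : Plane :=
  A.symm !₂[s, k s]

theorem graphMap_eq_of_eq {y : Plane} (h : (A y) 1 = k ((A y) 0)) :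
    graphMap A k ((A y) 0) = y := by
  rw [graphMap, LinearIsometryEquiv.symm_apply_eq, ← h]
  ext i
  fin_cases i <;> rfl

theorem lipschitzWith_graphMap (hk : LipschitzWith δ k) :
    LipschitzWith (1 + δ) (graphMap A k) := by
  suffices LipschitzWith (1 + δ) fun s => (!₂[s, k s] : Plane) by
    have := A.symm.lipschitz.comp this
    rw [one_mul] at this
    exact this
  refine LipschitzWith.of_dist_le_mul fun s t => ?_
  have h := hk.dist_le_mul s t
  rw [EuclideanSpace.dist_eq]
  simp only [Fin.sum_univ_two, Real.dist_eq] at h ⊢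
  refine Real.sqrt_le_iff.2 ⟨by positivity, ?_⟩
  simp only [Matrix.cons_val_zero, Matrix.cons_val_one, NNReal.coe_add, NNReal.coe_one, sq_abs]
  have h2 : (k s - k t) ^ 2 ≤ (δ * |s - t|) ^ 2 := by
    rw [← sq_abs (k s - k t)]
    gcongr
  have h3 : (s - t) ^ 2 = |s - t| ^ 2 := (sq_abs _).symm
  have := δ.2
  nlinarith [mul_nonneg δ.2 (sq_nonneg |s - t|)]

theorem IsFlatChart.continuous (h : IsFlatChart Ω V δ U A k) : Continuous k :=
  h.lipschitz.continuous

/-- In a flat chart the closure of the hard boundary lies on the graph. -/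
theorem IsFlatChart.eq_of_mem (h : IsFlatChart Ω V δ U A k) (hΩ : IsOpen Ω) {y : Plane}
    (hyU : y ∈ U) (hy : y ∈ closure (hardBoundary Ω V)) : (A y) 1 = k ((A y) 0) := by
  have hk := h.continuous
  have hsub : U ∩ hardBoundary Ω V ⊆ {z | (A z) 1 = k ((A z) 0)} := by
    rintro z ⟨hzU, hzΩ, hzV⟩
    rcases lt_trichotomy ((A z) 1) (k ((A z) 0)) with hlt | heq | hgt
    · refine absurd ?_ hzV.2
      rw [mem_interior]
      refine ⟨(U ∩ Ω) ∩ {z | (A z) 1 < k ((A z) 0)}, fun y hy => h.mem_of_lt y hy.1.1 hy.1.2 hy.2,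
        (h.isOpen.inter hΩ).inter (isOpen_lt (by fun_prop) (by fun_prop)), ⟨hzU, hzΩ⟩, hlt⟩
    · exact heq
    · rw [← frontier_compl] at hzV
      refine absurd ?_ hzV.2
      rw [mem_interior]
      refine ⟨(U ∩ Ω) ∩ {z | k ((A z) 0) < (A z) 1},
        fun y hy => h.notMem_of_lt y hy.1.1 hy.1.2 hy.2,
        (h.isOpen.inter hΩ).inter (isOpen_lt (by fun_prop) (by fun_prop)), ⟨hzU, hzΩ⟩, hgt⟩
  have hcl : IsClosed {z | (A z) 1 = k ((A z) 0)} := isClosed_eq (by fun_prop) (by fun_prop)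
  exact closure_minimal hsub hcl (h.isOpen.inter_closure ⟨hyU, hy⟩)

/-! ### Length and neighborhoods of the boundary -/

theorem measurePreserving_coord (A : Plane ≃ₗᵢ[ℝ] Plane) :
    MeasurePreserving (fun y : Plane => ((A y) 0, (A y) 1)) volume volume :=
  (volume_preserving_finTwoArrow ℝ).comp
    ((PiLp.volume_preserving_ofLp (Fin 2)).comp A.measurePreserving)

theorem lipschitzWith_coord (A : Plane ≃ₗᵢ[ℝ] Plane) (i : Fin 2) :
    LipschitzWith 1 fun y => (A y) i := by
  refine LipschitzWith.of_dist_le_mul fun y z => ?_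
  rw [NNReal.coe_one, one_mul, ← A.dist_map y z, Real.dist_eq, dist_eq_norm]
  simpa using PiLp.norm_apply_le (A y - A z) i

/-- The volume of a tube around a nearly straight graph: up to the factor `1 + δ`, it is the
thickness `2 r` times the length of the `r`-neighborhood of the projection to the first axis. -/
theorem IsFlatChart.volume_thickening_le (h : IsFlatChart Ω V δ U A k) (hΩ : IsOpen Ω)
    {S : Set Plane} (hSU : S ⊆ U) (hS : S ⊆ closure (hardBoundary Ω V)) {r : ℝ} (hr : 0 < r) :
    volume (Metric.thickening r S) ≤ ENNReal.ofReal (2 * r) *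
      ((1 + δ) * volume (Metric.cthickening r ((fun y => (A y) 0) '' S))) := by
  set P : Set ℝ := (fun y => (A y) 0) '' S
  have hk := h.continuous
  have hsub : Metric.thickening r S ⊆ (fun y : Plane => ((A y) 0, (A y) 1)) ⁻¹'
      regionBetween (fun s => k s - (1 + δ) * r) (fun s => k s + (1 + δ) * r)
        (Metric.cthickening r P) := by
    intro y hy
    obtain ⟨z, hz, hyz⟩ := Metric.mem_thickening_iff.1 hy
    have h0 := (lipschitzWith_coord A 0).dist_le_mul y z
    have h1 := (lipschitzWith_coord A 1).dist_le_mul y z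
    have h2 := h.lipschitz.dist_le_mul ((A y) 0) ((A z) 0)
    have h3 := h.eq_of_mem hΩ (hSU hz) (hS hz)
    rw [NNReal.coe_one, one_mul] at h0 h1
    have h4 : (δ : ℝ) * dist ((A y) 0) ((A z) 0) ≤ δ * r := by
      gcongr
      linarith
    rw [Real.dist_eq] at h1 h2
    rw [h3] at h1
    refine ⟨Metric.mem_cthickening_of_dist_le _ ((A z) 0) _ _ ⟨z, hz, rfl⟩ (by linarith), ?_, ?_⟩
    · linarith [(abs_le.1 h1).1, (abs_le.1 h2).2]
    · linarith [(abs_le.1 h1).2, (abs_le.1 h2).1]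
  have hm : MeasurableSet (Metric.cthickening r P) := Metric.isClosed_cthickening.measurableSet
  calc volume (Metric.thickening r S) ≤ _ := measure_mono hsub
    _ = _ := (measurePreserving_coord A).measure_preimage
        (measurableSet_regionBetween (by fun_prop) (by fun_prop) hm).nullMeasurableSet
    _ = _ := volume_regionBetween_eq_lintegral (by fun_prop) (by fun_prop) hm
    _ = ∫⁻ _ in Metric.cthickening r P, ENNReal.ofReal (2 * r) * (1 + δ) := by
        refine lintegral_congr fun s => ?_
        have : (1 + δ : ℝ≥0∞) = ENNReal.ofReal (1 + δ) := by
          rw [ENNReal.ofReal_add zero_le_one δ.coe_nonneg]; simp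
        rw [this, ← ENNReal.ofReal_mul (by linarith)]
        congr 1
        simp only [Pi.sub_apply]
        ring
    _ = _ := by rw [setLIntegral_const, mul_assoc]

theorem volume_coord_image_le (A : Plane ≃ₗᵢ[ℝ] Plane) (S : Set Plane) :
    volume ((fun y => (A y) 0) '' S) ≤ μH[1] S := by
  rw [← hausdorffMeasure_real]
  simpa using (lipschitzWith_coord A 0).hausdorffMeasure_image_le zero_le_one S

/-- On the graph in a flat chart, length is at most `1 + δ` times the length of the projection to
the first axis. -/
theorem IsFlatChart.hausdorffMeasure_le (h : IsFlatChart Ω V δ U A k) (hΩ : IsOpen Ω)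
    {S : Set Plane} (hSU : S ⊆ U) (hS : S ⊆ closure (hardBoundary Ω V)) :
    μH[1] S ≤ (1 + δ) * volume (graphMap A k ⁻¹' S) := by
  have hsub : S ⊆ graphMap A k '' (graphMap A k ⁻¹' S) := fun y hy => by
    have := graphMap_eq_of_eq (h.eq_of_mem hΩ (hSU hy) (hS hy))
    exact ⟨(A y) 0, by rw [mem_preimage, this]; exact hy, this⟩
  refine (measure_mono hsub).trans ?_
  rw [← hausdorffMeasure_real]
  simpa using (lipschitzWith_graphMap (A := A) h.lipschitz).hausdorffMeasure_image_le zero_le_one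
    (graphMap A k ⁻¹' S)

theorem graphMap_coord (s : ℝ) : (A (graphMap A k s)) 0 = s := by simp [graphMap]

theorem hausdorffMeasure_closure_hardBoundary_lt_top (hΩ : IsOpen Ω) (hb : Bornology.IsBounded Ω)
    (hreg : HasRegularBoundary Ω V) : μH[1] (closure (hardBoundary Ω V)) < ⊤ := by
  have hK : IsCompact (closure (hardBoundary Ω V)) :=
    (hb.subset inter_subset_left).isCompact_closure
  refine hK.measure_lt_top_of_nhdsWithin fun x hx => ?_
  obtain ⟨U, A, k, hxU, h⟩ := hreg.exists_isFlatChart hx one_pos le_rfl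
  obtain ⟨r, hr, hrU⟩ := Metric.nhds_basis_closedBall.mem_iff.1 (h.isOpen.mem_nhds hxU)
  refine ⟨closure (hardBoundary Ω V) ∩ Metric.closedBall x r,
    inter_mem self_mem_nhdsWithin
      (mem_nhdsWithin_of_mem_nhds (Metric.closedBall_mem_nhds x hr)), ?_⟩
  refine (h.hausdorffMeasure_le hΩ (inter_subset_right.trans hrU) inter_subset_left).trans_lt ?_
  refine ENNReal.mul_lt_top (by simp) ?_
  have hc := (hK.inter_right (Metric.isClosed_closedBall (x := x) (ε := r))).image
    (continuous_coord A 0)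
  refine (measure_mono ?_).trans_lt hc.measure_lt_top
  exact fun s hs => ⟨_, hs, graphMap_coord s⟩

/-- The volume of the tubes of radius `r` around a compact part `S` of the closed boundary, divided
by `2 r`, has a majorant with limit at most `(1 + δ) * μH[1] S`. The part `S` is covered by finitely
many balls inside flat charts. A ball whose boundary carries no length cuts `S` into two compact
parts whose lengths add up. -/
theorem exists_majorant_volume_thickening (hΩ : IsOpen Ω) {ι : Type*} (t : Finset ι)
    {B : ι → Set Plane} (hBopen : ∀ i, IsOpen (B i))
    (hB0 : ∀ i, μH[1] (closure (hardBoundary Ω V) ∩ frontier (B i)) = 0)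
    (hBflat : ∀ i, ∃ U A k, closure (B i) ⊆ U ∧ IsFlatChart Ω V δ U A k)
    {S : Set Plane} (hSc : IsCompact S) (hS : S ⊆ closure (hardBoundary Ω V))
    (hSt : S ⊆ ⋃ i ∈ t, B i) :
    ∃ (f : ℝ → ℝ≥0∞) (v : ℝ≥0∞), Tendsto f (𝓝[>] 0) (𝓝 v) ∧ v ≤ (1 + δ) * μH[1] S ∧
      ∀ r > 0, volume (Metric.thickening r S) ≤ ENNReal.ofReal (2 * r) * f r := by
  classical
  induction t using Finset.induction_on generalizing S with
  | empty =>
    have : S = ∅ := by simpa [subset_empty_iff] using hSt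
    exact ⟨fun _ => 0, 0, tendsto_const_nhds, zero_le, fun r _ => by simp [this]⟩
  | insert i t hi ih =>
    obtain ⟨f, v, hf, hv, hfr⟩ := ih (S := S \ B i) (hSc.diff (hBopen i)) (sdiff_subset.trans hS)
      (fun y hy => by
        have := hSt hy.1
        simp only [Finset.mem_insert, iUnion_iUnion_eq_or_left, mem_union] at this
        exact this.resolve_left hy.2)
    obtain ⟨U, A, k, hBU, h⟩ := hBflat i
    have hc1 : IsCompact (S ∩ closure (B i)) := hSc.inter_right isClosed_closure
    have hc2 := hc1.image (continuous_coord A 0)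
    refine ⟨fun r => (1 + δ) * volume (Metric.cthickening r ((fun y => (A y) 0) ''
        (S ∩ closure (B i)))) + f r,
      (1 + δ) * volume ((fun y => (A y) 0) '' (S ∩ closure (B i))) + v, ?_, ?_, fun r hr => ?_⟩
    · refine Tendsto.add (ENNReal.Tendsto.const_mul ?_ (Or.inr (by simp))) hf
      exact (tendsto_measure_cthickening_of_isCompact hc2).mono_left nhdsWithin_le_nhds
    · -- the two parts overlap only on the boundary of `B i`
      have hnull : μH[1] ((S ∩ closure (B i)) ∩ (S \ B i)) = 0 := by
        refine measure_mono_null ?_ (hB0 i)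
        rintro y ⟨⟨hyS, hy⟩, -, hyB⟩
        rw [(hBopen i).frontier_eq]
        exact ⟨hS hyS, hy, hyB⟩
      have hadd : μH[1] (S ∩ closure (B i)) + μH[1] (S \ B i) = μH[1] S := by
        rw [← measure_union₀ (hSc.diff (hBopen i)).measurableSet.nullMeasurableSet hnull]
        congr 1
        ext y
        have := @subset_closure _ _ (B i) y
        simp only [mem_union, mem_inter_iff, Set.mem_sdiff]
        tauto
      calc _ ≤ (1 + δ) * μH[1] (S ∩ closure (B i)) + (1 + δ) * μH[1] (S \ B i) := by
            gcongr
            exact volume_coord_image_le A _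
        _ = _ := by rw [← mul_add, hadd]
    · have hsub : Metric.thickening r S ⊆
          Metric.thickening r (S ∩ closure (B i)) ∪ Metric.thickening r (S \ B i) := by
        rw [← Metric.thickening_union]
        refine Metric.thickening_subset_of_subset _ fun y hy => ?_
        by_cases hyB : y ∈ B i
        · exact Or.inl ⟨hy, subset_closure hyB⟩
        · exact Or.inr ⟨hy, hyB⟩
      calc _ ≤ _ := (measure_mono hsub).trans (measure_union_le _ _)
        _ ≤ _ := add_le_add (h.volume_thickening_le hΩ (inter_subset_right.trans hBU)
              (inter_subset_left.trans hS) hr) (hfr r hr)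
        _ = _ := by rw [← mul_add]

theorem tendsto_one_add_mul {a : ℝ≥0∞} (ha : a ≠ ⊤) :
    Tendsto (fun δ : ℝ≥0 => (1 + δ : ℝ≥0∞) * a) (𝓝[>] 0) (𝓝 a) := by
  have h1 : Tendsto (fun δ : ℝ≥0 => (1 + δ : ℝ≥0∞)) (𝓝[>] 0) (𝓝 (1 + (0 : ℝ≥0))) :=
    (tendsto_const_nhds.add (ENNReal.tendsto_coe.2 tendsto_id)).mono_left nhdsWithin_le_nhds
  simpa using ENNReal.Tendsto.mul_const h1 (Or.inr ha)

/-- The upper Minkowski content of the closed boundary is at most its length. -/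
theorem eventually_volume_thickening_le (hΩ : IsOpen Ω) (hb : Bornology.IsBounded Ω)
    (hreg : HasRegularBoundary Ω V) {c : ℝ≥0∞} (hc : μH[1] (closure (hardBoundary Ω V)) < c) :
    ∀ᶠ r in 𝓝[>] (0 : ℝ), volume (Metric.thickening r (closure (hardBoundary Ω V))) ≤
      ENNReal.ofReal (2 * r) * c := by
  set K := closure (hardBoundary Ω V) with hKdef
  have hK : IsCompact K := (hb.subset inter_subset_left).isCompact_closure
  have hfin : μH[1] K < ⊤ := hausdorffMeasure_closure_hardBoundary_lt_top hΩ hb hreg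
  obtain ⟨δ, hδ0, hδ1, hδc⟩ : ∃ δ : ℝ≥0, 0 < δ ∧ δ ≤ 1 ∧ (1 + δ) * μH[1] K < c := by
    have h2 := ((tendsto_one_add_mul hfin.ne).eventually_lt_const hc).and
      (Ioc_mem_nhdsGT (zero_lt_one : (0 : ℝ≥0) < 1))
    obtain ⟨δ, h3, h4⟩ := h2.exists
    exact ⟨δ, h4.1, h4.2, h3⟩
  have : IsFiniteMeasure (μH[1].restrict K : Measure Plane) := ⟨by simpa using hfin⟩
  have hball : ∀ x : K, ∃ B : Set Plane, IsOpen B ∧ x.1 ∈ B ∧ μH[1] (K ∩ frontier B) = 0 ∧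
      ∃ U A k, closure B ⊆ U ∧ IsFlatChart Ω V δ U A k := by
    intro x
    obtain ⟨U, A, k, hxU, h⟩ := hreg.exists_isFlatChart x.2 hδ0 hδ1
    obtain ⟨r, hr, hrU⟩ := Metric.nhds_basis_closedBall.mem_iff.1 (h.isOpen.mem_nhds hxU)
    obtain ⟨ρ, hρ, h0⟩ := exists_null_frontier_thickening (μH[1].restrict K) {x.1} hr
    rw [Metric.thickening_singleton, Measure.restrict_apply isClosed_frontier.measurableSet,
      inter_comm] at h0
    refine ⟨Metric.ball x.1 ρ, Metric.isOpen_ball, Metric.mem_ball_self hρ.1, h0, U, A, k, ?_, h⟩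
    exact (Metric.closure_ball_subset_closedBall.trans
      (Metric.closedBall_subset_closedBall hρ.2.le)).trans hrU
  choose B hBo hxB hB0 hBf using hball
  obtain ⟨t, ht⟩ := hK.elim_finite_subcover B hBo fun x hx => mem_iUnion.2 ⟨⟨x, hx⟩, hxB ⟨x, hx⟩⟩
  obtain ⟨f, v, hf, hv, hfr⟩ :=
    exists_majorant_volume_thickening hΩ t hBo hB0 hBf hK subset_rfl ht
  filter_upwards [hf.eventually_lt_const (hv.trans_lt hδc), self_mem_nhdsWithin] with r hr hr0
  exact (hfr r hr0).trans (by gcongr)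

/-- Regularity up to the boundary of the domain makes the closed boundary as long as the boundary
itself. -/
theorem HasRegularBoundary.hausdorffMeasure_closure (hΩ : IsOpen Ω)
    (hreg : HasRegularBoundary Ω V) :
    μH[1] (closure (hardBoundary Ω V)) = μH[1] (hardBoundary Ω V) := by
  refine le_antisymm ?_ (measure_mono subset_closure)
  have hsub : closure (hardBoundary Ω V) ⊆
      hardBoundary Ω V ∪ (closure (hardBoundary Ω V) ∩ frontier Ω) := by
    intro x hx
    by_cases hxΩ : x ∈ Ω
    · exact Or.inl ⟨hxΩ, closure_minimal inter_subset_right isClosed_frontier hx⟩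
    · refine Or.inr ⟨hx, ?_⟩
      rw [hΩ.frontier_eq]
      exact ⟨closure_mono inter_subset_left hx, hxΩ⟩
  calc _ ≤ _ := (measure_mono hsub).trans (measure_union_le _ _)
    _ = _ := by rw [hreg.null_contact, add_zero]

/-! ### Length is bounded by total variation -/

theorem HasRegularBoundary.volume_closure_eq_zero (hreg : HasRegularBoundary Ω V)
    (hΩ : IsOpen Ω) (hb : Bornology.IsBounded Ω) :
    volume (closure (hardBoundary Ω V)) = 0 := by
  set K := closure (hardBoundary Ω V)
  have hfin : μH[1] K < ⊤ := hausdorffMeasure_closure_hardBoundary_lt_top hΩ hb hreg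
  obtain ⟨c, hc, hc'⟩ := exists_between hfin
  have hle := eventually_volume_thickening_le hΩ hb hreg hc
  have hlim : Tendsto (fun r : ℝ => ENNReal.ofReal (2 * r) * c) (𝓝[>] 0) (𝓝 0) := by
    have h1 : Tendsto (fun r : ℝ => ENNReal.ofReal (2 * r)) (𝓝[>] 0) (𝓝 0) := by
      have : Continuous fun r : ℝ => ENNReal.ofReal (2 * r) :=
        ENNReal.continuous_ofReal.comp (by fun_prop)
      simpa using (this.tendsto 0).mono_left nhdsWithin_le_nhds
    simpa using ENNReal.Tendsto.mul_const h1 (Or.inr hc'.ne)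
  refine le_antisymm (ge_of_tendsto hlim ?_) zero_le
  filter_upwards [hle, self_mem_nhdsWithin] with r hr hr0
  exact (measure_mono (Metric.self_subset_thickening hr0 _)).trans hr

theorem HasRegularBoundary.nullMeasurableSet (hreg : HasRegularBoundary Ω V)
    (hΩ : IsOpen Ω) (hb : Bornology.IsBounded Ω) (hV : V ⊆ Ω) : NullMeasurableSet V volume := by
  refine NullMeasurableSet.congr (s := interior V)
    isOpen_interior.measurableSet.nullMeasurableSet ?_
  refine (ae_le_set.2 ?_).antisymm (ae_le_set.2 ?_)
  · simp [sdiff_eq_empty.2 interior_subset]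
  · refine measure_mono_null ?_ (hreg.volume_closure_eq_zero hΩ hb)
    exact fun x hx => subset_closure ⟨hV hx.1, subset_closure hx.1, hx.2⟩

/-- The divergence theorem in a flat chart for fields of constant direction: the integral over `V`
of the derivative in the vertical direction of the chart is an integral over the graph. -/
theorem IsFlatChart.setIntegral_fderiv (h : IsFlatChart Ω V δ U A k) (hΩ : IsOpen Ω)
    {φ : Plane → ℝ} (hφ : ContDiff ℝ 1 φ) (hφc : HasCompactSupport φ)
    (hφs : tsupport φ ⊆ U ∩ Ω) :
    ∫ x in Ω, V.indicator (fun _ => (1 : ℝ)) x *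
      fderiv ℝ φ x (A.symm (EuclideanSpace.single 1 1)) = ∫ s, φ (graphMap A k s) := by
  set w : Plane := A.symm (EuclideanSpace.single 1 1)
  have hk := h.continuous
  have hw : w ≠ 0 := by simp [w]
  have hFcont : Continuous fun x => fderiv ℝ φ x w :=
    (hφ.continuous_fderiv one_ne_zero).clm_apply continuous_const
  have hFint : Integrable fun x => fderiv ℝ φ x w :=
    hFcont.integrable_of_hasCompactSupport (hφc.fderiv_apply ℝ w)
  have hF0 : ∀ x, x ∉ U ∩ Ω → fderiv ℝ φ x w = 0 := fun x hx => by
    have : fderiv ℝ φ x = 0 :=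
      image_eq_zero_of_notMem_tsupport fun h => hx (hφs (tsupport_fderiv_subset ℝ h))
    simp [this]
  set E : Set (ℝ × ℝ) := {p | p.2 ≤ k p.1}
  have hE : MeasurableSet E := measurableSet_le (by fun_prop) (by fun_prop)
  let T : Plane → ℝ × ℝ := fun y => ((A y) 0, (A y) 1)
  let q : ℝ → Plane := fun s => A.symm !₂[s, 0]
  have hqcont : Continuous q := by fun_prop
  have hq : ∀ s t, q s + t • w = A.symm !₂[s, t] := fun s t => by
    rw [← map_smul, ← map_add]
    congr 1
    ext i
    fin_cases i <;> simp
  have hT : MeasurePreserving T volume volume := measurePreserving_coord A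
  have hqT : ∀ x, q (T x).1 + (T x).2 • w = x := fun x => by
    rw [hq, LinearIsometryEquiv.symm_apply_eq]
    ext i
    fin_cases i <;> rfl
  let G : ℝ × ℝ → ℝ := E.indicator fun p => fderiv ℝ φ (q p.1 + p.2 • w) w
  have hGmeas : AEStronglyMeasurable G (volume : Measure (ℝ × ℝ)) := by
    refine (Continuous.aestronglyMeasurable ?_).indicator hE
    exact hFcont.comp (by fun_prop)
  have hGT : G ∘ T = (T ⁻¹' E).indicator fun x => fderiv ℝ φ x w := by
    ext x
    simp only [G, Function.comp_apply, indicator_apply, hqT]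
    rfl
  have hGint : Integrable G (volume : Measure (ℝ × ℝ)) := by
    rw [← hT.integrable_comp hGmeas, hGT]
    exact hFint.indicator (hT.measurable hE)
  -- membership in `V` is undetermined on the graph, a null set
  have hnull : ∀ᵐ x : Plane, (T x).2 ≠ k (T x).1 := by
    have hm : MeasurableSet {p : ℝ × ℝ | p.2 = k p.1} :=
      measurableSet_eq_fun (by fun_prop) (by fun_prop)
    have h0 : volume {p : ℝ × ℝ | p.2 = k p.1} = 0 := by
      rw [Measure.volume_eq_prod, Measure.measure_prod_null hm]
      exact Eventually.of_forall fun s => measure_mono_null (t := {k s}) (fun t ht => ht) (by simp)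
    exact hT.quasiMeasurePreserving.ae (measure_eq_zero_iff_ae_notMem.1 h0)
  have hfirst : ∫ x in Ω, V.indicator (fun _ => (1 : ℝ)) x * fderiv ℝ φ x w = ∫ x, G (T x) := by
    rw [← integral_indicator hΩ.measurableSet]
    refine integral_congr_ae ?_
    filter_upwards [hnull] with x hx
    change _ = (G ∘ T) x
    rw [hGT]
    by_cases hxU : x ∈ U ∩ Ω
    · rw [indicator_of_mem hxU.2]
      rcases lt_or_gt_of_ne hx with hlt | hgt
      · have h1 : x ∈ V := h.mem_of_lt x hxU.1 hxU.2 hlt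
        have h2 : x ∈ T ⁻¹' E := hlt.le
        simp [h1, h2]
      · have h1 : x ∉ V := h.notMem_of_lt x hxU.1 hxU.2 hgt
        have h2 : x ∉ T ⁻¹' E := not_le.2 hgt
        simp [h1, h2]
    · classical
      simp [indicator_apply, hF0 x hxU]
  have hsecond : ∫ x, G (T x) = ∫ p, G p := by
    rw [← hT.map_eq] at hGmeas
    rw [← integral_map hT.aemeasurable hGmeas, hT.map_eq]
  rw [hfirst, hsecond, Measure.volume_eq_prod, integral_prod _ hGint]
  refine integral_congr_ae (Eventually.of_forall fun s => ?_)
  have hline : ContDiff ℝ 1 fun t : ℝ => φ (q s + t • w) := hφ.comp (by fun_prop)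
  have hcl : IsClosedEmbedding fun t : ℝ => q s + t • w :=
    (Homeomorph.addLeft (q s)).isClosedEmbedding.comp (isClosedEmbedding_smul_left hw)
  have hlinec : HasCompactSupport fun t : ℝ => φ (q s + t • w) := hφc.comp_isClosedEmbedding hcl
  have hderiv : ∀ t, deriv (fun t : ℝ => φ (q s + t • w)) t = fderiv ℝ φ (q s + t • w) w := by
    intro t
    have h1 : HasDerivAt (fun t : ℝ => q s + t • w) w t := by
      simpa using ((hasDerivAt_id t).smul_const w).const_add (q s)
    exact ((hφ.differentiable one_ne_zero _).hasFDerivAt.comp_hasDerivAt t h1).deriv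
  calc ∫ t, G (s, t) = ∫ t in Iic (k s), deriv (fun t : ℝ => φ (q s + t • w)) t := by
        rw [← integral_indicator measurableSet_Iic]
        refine integral_congr_ae (Eventually.of_forall fun t => ?_)
        simp only [G, E, indicator_apply, mem_ofPred_eq, mem_Iic, hderiv]
    _ = φ (q s + k s • w) := hlinec.integral_Iic_deriv_eq hline _
    _ = _ := by rw [hq]; rfl

theorem divergence_sum_smul {ι : Type*} [Fintype ι] {φ : ι → Plane → ℝ}
    (hφ : ∀ i, Differentiable ℝ (φ i)) (w : ι → Plane) (x : Plane) :
    divergence (fun x => ∑ i, φ i x • w i) x = ∑ i, fderiv ℝ (φ i) x (w i) := by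
  have h1 : HasFDerivAt (fun x => ∑ i, φ i x • w i)
      (∑ i, (fderiv ℝ (φ i) x).smulRight (w i)) x :=
    HasFDerivAt.fun_sum fun i _ => (hφ i x).hasFDerivAt.smul_const (w i)
  have h2 : ∀ v : Plane, v = ∑ j : Fin 2, v j • EuclideanSpace.single j (1 : ℝ) := fun v => by
    ext j
    fin_cases j <;> simp
  rw [divergence, h1.fderiv]
  simp only [FunLike.coe_sum, Finset.sum_apply, ContinuousLinearMap.smulRight_apply]
  have h3 : ∀ i, fderiv ℝ (φ i) x (w i) =
      ∑ j : Fin 2, fderiv ℝ (φ i) x (EuclideanSpace.single j 1) * w i j := fun i => by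
    conv_lhs => rw [h2 (w i)]
    simp [mul_comm]
  simp only [h3]
  rw [Finset.sum_comm]
  refine Finset.sum_congr rfl fun j _ => ?_
  simp

/-- In a flat chart, length on the boundary is controlled by integration over the graph. -/
theorem IsFlatChart.setLIntegral_le (h : IsFlatChart Ω V δ U A k) (hΩ : IsOpen Ω) {S : Set Plane}
    (hSm : MeasurableSet S) (hS : S ⊆ closure (hardBoundary Ω V)) {φ : Plane → ℝ}
    (hφ : Continuous φ) (hφ0 : ∀ x, 0 ≤ φ x) (hφc : HasCompactSupport φ) (hφs : tsupport φ ⊆ U) :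
    ∫⁻ x in S, ENNReal.ofReal (φ x) ∂μH[1] ≤
      (1 + δ) * ENNReal.ofReal (∫ s, φ (graphMap A k s)) := by
  have hγ : Continuous (graphMap A k) := (lipschitzWith_graphMap h.lipschitz).continuous
  have hle : (μH[1] : Measure Plane).restrict (S ∩ U) ≤
      (1 + δ : ℝ≥0∞) • Measure.map (graphMap A k) volume := by
    refine Measure.le_iff.2 fun E hE => ?_
    rw [Measure.restrict_apply hE, Measure.smul_apply, Measure.map_apply hγ.measurable hE]
    refine (h.hausdorffMeasure_le hΩ (inter_subset_right.trans inter_subset_right)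
      ((inter_subset_right.trans inter_subset_left).trans hS)).trans ?_
    rw [smul_eq_mul]
    gcongr
    exact inter_subset_left
  have hint : Integrable fun s => φ (graphMap A k s) := by
    refine (hφ.comp hγ).integrable_of_hasCompactSupport
      (HasCompactSupport.intro (hφc.isCompact.image (continuous_coord A 0)) fun s hs => ?_)
    by_contra hne
    exact hs ⟨graphMap A k s, subset_tsupport _ hne, graphMap_coord s⟩
  have hrestr : ∫⁻ x in S, ENNReal.ofReal (φ x) ∂μH[1] =
      ∫⁻ x in S ∩ U, ENNReal.ofReal (φ x) ∂μH[1] := by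
    rw [← lintegral_indicator hSm, ← lintegral_indicator (hSm.inter h.isOpen.measurableSet)]
    classical
    refine lintegral_congr fun x => ?_
    by_cases hx : x ∈ U
    · simp [indicator_apply, hx]
    · have : φ x = 0 := image_eq_zero_of_notMem_tsupport fun h => hx (hφs h)
      simp [indicator_apply, this]
  calc _ = _ := hrestr
    _ ≤ ∫⁻ x, ENNReal.ofReal (φ x) ∂((1 + δ : ℝ≥0∞) • Measure.map (graphMap A k) volume) :=
        lintegral_mono' hle le_rfl
    _ = _ := by
      rw [lintegral_smul_measure, lintegral_map (by fun_prop) hγ.measurable,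
        ofReal_integral_eq_lintegral_ofReal hint (Eventually.of_forall fun s => hφ0 _), smul_eq_mul]

/-- The total variation of the indicator of `V` controls the length of compact parts of the
boundary. The vector field is glued by a partition of unity from the constant vertical directions
of flat charts, each of which is nearly normal to the boundary. -/
theorem hausdorffMeasure_isCompact_le (hΩ : IsOpen Ω) (hb : Bornology.IsBounded Ω) (hV : V ⊆ Ω)
    (hreg : HasRegularBoundary Ω V) {S : Set Plane} (hSc : IsCompact S)
    (hS : S ⊆ hardBoundary Ω V) (hδ : 0 < δ) (hδ1 : δ ≤ 1) :
    μH[1] S ≤ (1 + δ) * totalVariation Ω (V.indicator fun _ => (1 : ℝ)) := by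
  have hchart : ∀ x : S, ∃ U A k, x.1 ∈ U ∧ U ⊆ Ω ∧ IsFlatChart Ω V δ U A k := by
    intro x
    obtain ⟨U, A, k, hxU, h⟩ := hreg.exists_isFlatChart (subset_closure (hS x.2)) hδ hδ1
    exact ⟨U ∩ Ω, A, k, ⟨hxU, (hS x.2).1⟩, inter_subset_right,
      h.mono (h.isOpen.inter hΩ) inter_subset_left⟩
  choose U A k hxU hUΩ h using hchart
  obtain ⟨t, ht⟩ := hSc.elim_finite_subcover U (fun x => (h x).isOpen)
    fun x hx => mem_iUnion.2 ⟨⟨x, hx⟩, hxU ⟨x, hx⟩⟩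
  obtain ⟨ρ, hρ⟩ := SmoothPartitionOfUnity.exists_isSubordinate (modelWithCornersSelf ℝ Plane)
    hSc.isClosed (fun i : t => U i) (fun i => (h i).isOpen) (by rwa [iUnion_subtype])
  have hρU : ∀ i : t, tsupport (ρ i) ⊆ U i := hρ
  have hsmooth : ∀ i : t, ContDiff ℝ 1 (ρ i) := fun i =>
    ((ρ i).contMDiff.contDiff).of_le (by exact_mod_cast le_top)
  have hsum : ∀ x, ∑ i, ρ i x = ∑ᶠ i, ρ i x := fun x => (finsum_eq_sum_of_fintype _).symm
  have hcomp : ∀ i : t, HasCompactSupport (ρ i) := fun i =>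
    Metric.isCompact_of_isClosed_isBounded (isClosed_tsupport _)
      (hb.subset ((hρU i).trans (hUΩ i)))
  let w : t → Plane := fun i => (A i).symm (EuclideanSpace.single 1 1)
  have hw : ∀ i, ‖w i‖ = 1 := fun i => by simp [w]
  let g : Plane → Plane := fun x => ∑ i, ρ i x • w i
  have hgsupp : tsupport g ⊆ ⋃ i : t, tsupport (ρ i) := by
    refine closure_minimal (fun x hx => ?_) (isClosed_iUnion_of_finite fun i => isClosed_tsupport _)
    by_contra hne
    simp only [mem_iUnion, not_exists] at hne
    refine hx (Finset.sum_eq_zero fun i _ => ?_)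
    rw [image_eq_zero_of_notMem_tsupport (hne i), zero_smul]
  have hgΩ : tsupport g ⊆ Ω := hgsupp.trans (iUnion_subset fun i => (hρU i).trans (hUΩ i))
  have hgadm : ContDiff ℝ 1 g ∧ HasCompactSupport g ∧ tsupport g ⊆ Ω ∧ ∀ x, ‖g x‖ ≤ 1 := by
    refine ⟨ContDiff.sum fun i _ => (hsmooth i).smul contDiff_const,
      Metric.isCompact_of_isClosed_isBounded (isClosed_tsupport _) (hb.subset hgΩ), hgΩ,
      fun x => ?_⟩
    calc ‖g x‖ ≤ ∑ i, ‖ρ i x • w i‖ := norm_sum_le _ _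
      _ = ∑ i, ρ i x := Finset.sum_congr rfl fun i _ => by
          rw [norm_smul, hw, mul_one, Real.norm_of_nonneg (ρ.nonneg i x)]
      -- the partition of unity sums to one only on `S`, and to at most one elsewhere
      _ ≤ 1 := (hsum x).trans_le (ρ.sum_le_one x)
  have hdiv : ∫ x in Ω, V.indicator (fun _ => (1 : ℝ)) x * divergence g x =
      ∑ i : t, ∫ s, ρ i (graphMap (A i) (k i) s) := by
    have h1 : ∀ x, divergence g x = ∑ i, fderiv ℝ (ρ i) x (w i) :=
      divergence_sum_smul (fun i => (hsmooth i).differentiable one_ne_zero) w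
    simp only [h1, Finset.mul_sum]
    rw [integral_finsetSum]
    · exact Finset.sum_congr rfl fun i _ =>
        (h i).setIntegral_fderiv hΩ (hsmooth i) (hcomp i) (subset_inter (hρU i)
          ((hρU i).trans (hUΩ i)))
    · intro i _
      have hint : Integrable fun x => fderiv ℝ (ρ i) x (w i) :=
        (((hsmooth i).continuous_fderiv one_ne_zero).clm_apply
          continuous_const).integrable_of_hasCompactSupport ((hcomp i).fderiv_apply ℝ (w i))
      refine (hint.indicator₀ (hreg.nullMeasurableSet hΩ hb hV)).restrict.congr ?_
      exact Eventually.of_forall fun x => by by_cases hx : x ∈ V <;> simp [hx]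
  have hone : ∀ x ∈ S, ∑ i, ENNReal.ofReal (ρ i x) = 1 := fun x hx => by
    rw [← ENNReal.ofReal_sum_of_nonneg fun i _ => ρ.nonneg i x, hsum, ρ.sum_eq_one hx,
      ENNReal.ofReal_one]
  calc μH[1] S = ∫⁻ x in S, ∑ i, ENNReal.ofReal (ρ i x) ∂μH[1] := by
        rw [setLIntegral_congr_fun hSc.measurableSet hone]
        simp
    _ = ∑ i, ∫⁻ x in S, ENNReal.ofReal (ρ i x) ∂μH[1] :=
        lintegral_finsetSum _ fun i _ => (hsmooth i).continuous.measurable.ennreal_ofReal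
    _ ≤ ∑ i, (1 + δ) * ENNReal.ofReal (∫ s, ρ i (graphMap (A i) (k i) s)) :=
        Finset.sum_le_sum fun i _ => (h i).setLIntegral_le hΩ hSc.measurableSet
          (hS.trans subset_closure) (hsmooth i).continuous (ρ.nonneg i) (hcomp i) (hρU i)
    _ = (1 + δ) * ENNReal.ofReal (∫ x in Ω, V.indicator (fun _ => (1 : ℝ)) x * divergence g x) := by
        rw [hdiv, ← Finset.mul_sum, ENNReal.ofReal_sum_of_nonneg]
        exact fun i _ => integral_nonneg fun s => ρ.nonneg i _
    _ ≤ _ := by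
        gcongr
        exact le_iSup₂_of_le g hgadm le_rfl

theorem hausdorffMeasure_hardBoundary_le_totalVariation (hΩ : IsOpen Ω)
    (hb : Bornology.IsBounded Ω) (hV : V ⊆ Ω) (hreg : HasRegularBoundary Ω V) :
    μH[1] (hardBoundary Ω V) ≤ totalVariation Ω (V.indicator fun _ => (1 : ℝ)) := by
  set TV := totalVariation Ω (V.indicator fun _ => (1 : ℝ))
  have hm : MeasurableSet (hardBoundary Ω V) :=
    hΩ.measurableSet.inter isClosed_frontier.measurableSet
  have hfin : μH[1] (hardBoundary Ω V) < ⊤ := (measure_mono subset_closure).trans_lt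
    (hausdorffMeasure_closure_hardBoundary_lt_top hΩ hb hreg)
  have : IsFiniteMeasure (μH[1].restrict (hardBoundary Ω V) : Measure Plane) :=
    ⟨by simpa using hfin⟩
  refine le_of_forall_lt fun c hc => ?_
  have hc' : c < (μH[1].restrict (hardBoundary Ω V)) (hardBoundary Ω V) := by
    rwa [Measure.restrict_apply_self]
  obtain ⟨S, hS, hSc, hcS⟩ := hm.exists_lt_isCompact_of_ne_top
    (by rw [Measure.restrict_apply_self]; exact hfin.ne) hc'
  rw [Measure.restrict_apply hSc.measurableSet, inter_eq_left.2 hS] at hcS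
  refine hcS.trans_le ?_
  rcases eq_or_ne TV ⊤ with htop | htop
  · rw [htop]; exact le_top
  refine ge_of_tendsto (tendsto_one_add_mul htop) ?_
  filter_upwards [Ioc_mem_nhdsGT (zero_lt_one : (0 : ℝ≥0) < 1)] with δ hδ
  exact hausdorffMeasure_isCompact_le hΩ hb hV hreg hSc hS hδ.1 hδ.2

/-! ### The signed distance -/

/-- Inside the domain, a segment from a point of `V` to a point outside `V` meets the boundary. -/
theorem infDist_add_infDist_le {C : Set Plane} (hC : Convex ℝ C) (hCΩ : C ⊆ Ω) {x y : Plane}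
    (hx : x ∈ C) (hy : y ∈ C) (hxV : x ∈ V) (hyV : y ∉ V) :
    Metric.infDist x (hardBoundary Ω V) + Metric.infDist y (hardBoundary Ω V) ≤ dist x y := by
  obtain ⟨z, hz, hzV⟩ : ∃ z ∈ segment ℝ x y, z ∈ frontier V := by
    by_contra! hne
    have hcov : segment ℝ x y ⊆ interior V ∪ interior Vᶜ := fun z hz => by
      rw [interior_compl]
      by_contra hz'
      simp only [mem_union, mem_compl_iff, not_or, not_not] at hz'
      exact hne z hz ⟨hz'.2, hz'.1⟩
    rcases (convex_segment x y).isPreconnected.subset_or_subset isOpen_interior isOpen_interior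
      (disjoint_compl_right.mono interior_subset interior_subset) hcov with h | h
    · exact hyV (interior_subset (h (right_mem_segment ℝ x y)))
    · exact interior_subset (h (left_mem_segment ℝ x y)) hxV
  have hzΓ : z ∈ hardBoundary Ω V := ⟨hCΩ (hC.segment_subset hx hy hz), hzV⟩
  rw [← dist_add_dist_of_mem_segment hz, dist_comm z y]
  exact add_le_add (Metric.infDist_le_dist_of_mem hzΓ) (Metric.infDist_le_dist_of_mem hzΓ)

theorem lipschitzOnWith_signedDistance {C : Set Plane} (hC : Convex ℝ C) (hCΩ : C ⊆ Ω) :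
    LipschitzOnWith 1 (signedDistance Ω V) C := by
  refine LipschitzOnWith.of_dist_le_mul fun x hx y hy => ?_
  have h1 := Metric.infDist_le_infDist_add_dist (s := hardBoundary Ω V) (x := x) (y := y)
  have h2 := Metric.infDist_le_infDist_add_dist (s := hardBoundary Ω V) (x := y) (y := x)
  rw [dist_comm y x] at h2
  have h3 := Metric.infDist_nonneg (s := hardBoundary Ω V) (x := x)
  have h4 := Metric.infDist_nonneg (s := hardBoundary Ω V) (x := y)
  rw [NNReal.coe_one, one_mul, Real.dist_eq, abs_le, signedDistance, signedDistance]
  by_cases hxV : x ∈ V <;> by_cases hyV : y ∈ V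
  · rw [if_pos hxV, if_pos hyV]
    constructor <;> linarith
  · have := infDist_add_infDist_le hC hCΩ hx hy hxV hyV
    rw [if_pos hxV, if_neg hyV]
    constructor <;> linarith
  · have := infDist_add_infDist_le hC hCΩ hy hx hyV hxV
    rw [dist_comm y x] at this
    rw [if_neg hxV, if_pos hyV]
    constructor <;> linarith
  · rw [if_neg hxV, if_neg hyV]
    constructor <;> linarith

theorem exists_ball_lipschitzOnWith_signedDistance (hΩ : IsOpen Ω) {x : Plane} (hx : x ∈ Ω) :
    ∃ r > 0, LipschitzOnWith 1 (signedDistance Ω V) (Metric.ball x r) := by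
  obtain ⟨r, hr, hrΩ⟩ := Metric.isOpen_iff.1 hΩ x hx
  exact ⟨r, hr, lipschitzOnWith_signedDistance (convex_ball x r) hrΩ⟩

theorem locallyLipschitzOn_comp_signedDistance (hΩ : IsOpen Ω) {ψ : ℝ → ℝ} {M : ℝ≥0}
    (hψ : LipschitzWith M ψ) : LocallyLipschitzOn Ω fun x => ψ (signedDistance Ω V x) := by
  intro x hx
  obtain ⟨r, hr, h⟩ := exists_ball_lipschitzOnWith_signedDistance (V := V) hΩ hx
  exact ⟨M * 1, _, mem_nhdsWithin_of_mem_nhds (Metric.ball_mem_nhds x hr),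
    hψ.comp_lipschitzOnWith h⟩

/-- Rademacher's theorem on an open set. -/
theorem ae_differentiableAt_of_locallyLipschitzOn (hΩ : IsOpen Ω) {f : Plane → ℝ}
    (hf : LocallyLipschitzOn Ω f) : ∀ᵐ x ∂volume.restrict Ω, DifferentiableAt ℝ f x := by
  rw [ae_restrict_iff' hΩ.measurableSet, ae_iff]
  refine measure_null_of_locally_null _ fun x hx => ?_
  simp only [Classical.not_imp, mem_ofPred_eq] at hx
  obtain ⟨M, t, ht, hlip⟩ := hf hx.1
  rw [hΩ.nhdsWithin_eq hx.1] at ht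
  obtain ⟨F, hF, hFf⟩ := hlip.extend_real
  -- near `x` the function agrees with a globally Lipschitz one
  refine ⟨interior t ∩ _, inter_mem (mem_nhdsWithin_of_mem_nhds (interior_mem_nhds.2 ht))
    self_mem_nhdsWithin, ?_⟩
  refine measure_mono_null ?_ (ae_iff.1 (hF.ae_differentiableAt (μ := volume)))
  rintro y ⟨hyt, hy⟩ hyF
  simp only [Classical.not_imp, mem_ofPred_eq] at hy
  refine hy.2 (hyF.congr_of_eventuallyEq ?_)
  filter_upwards [isOpen_interior.mem_nhds hyt] with z hz using hFf (interior_subset hz)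

/-- The signed distance is differentiable almost everywhere, with slope at most one. -/
theorem ae_hasFDerivAt_signedDistance (hΩ : IsOpen Ω) : ∀ᵐ x ∂volume.restrict Ω,
    ∃ L : Plane →L[ℝ] ℝ, HasFDerivAt (signedDistance Ω V) L x ∧ ‖L‖ ≤ 1 := by
  filter_upwards [ae_differentiableAt_of_locallyLipschitzOn hΩ
    (locallyLipschitzOn_comp_signedDistance (V := V) hΩ LipschitzWith.id),
    ae_restrict_mem hΩ.measurableSet] with x hx hxΩ
  obtain ⟨r, hr, h⟩ := exists_ball_lipschitzOnWith_signedDistance (V := V) hΩ hxΩ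
  exact ⟨_, hx.hasFDerivAt, norm_fderiv_le_of_lipschitzOn ℝ (Metric.ball_mem_nhds x hr) h⟩

/-! ### Integration by parts -/

/-- The divergence is the sum of the directional derivatives of the coordinates. -/
theorem divergence_eq_sum {g : Plane → Plane} (hg : Differentiable ℝ g) (x : Plane) :
    divergence g x = ∑ i : Fin 2, fderiv ℝ (fun y => g y i) x (EuclideanSpace.single i 1) := by
  refine Finset.sum_congr rfl fun i _ => ?_
  have : HasFDerivAt (fun y => g y i) ((EuclideanSpace.proj i).comp (fderiv ℝ g x)) x :=
    (EuclideanSpace.proj (𝕜 := ℝ) i).hasFDerivAt.comp x (hg x).hasFDerivAt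
  rw [this.fderiv]
  rfl

/-- Integration by parts for a function that is locally Lipschitz in the domain against a `C¹` field
with compact support in the domain. On a neighborhood of the support the function agrees with
a Lipschitz function on the whole plane. -/
theorem setIntegral_mul_divergence (hΩ : IsOpen Ω) {f : Plane → ℝ} (hf : LocallyLipschitzOn Ω f)
    {g : Plane → Plane} (hg : ContDiff ℝ 1 g) (hgc : HasCompactSupport g) (hgs : tsupport g ⊆ Ω) :
    ∫ x in Ω, f x * divergence g x = - ∫ x in Ω, fderiv ℝ f x (g x) := by
  obtain ⟨K, hK, hgK, hKΩ⟩ := exists_compact_between hgc.isCompact hΩ hgs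
  obtain ⟨M, hM⟩ := LocallyLipschitzOn.exists_lipschitzOnWith_of_compact hK (hf.mono hKΩ)
  obtain ⟨F, hF, hFf⟩ := hM.extend_real
  let G : Fin 2 → Plane → ℝ := fun i y => g y i
  have hGdiff : ∀ i, ContDiff ℝ 1 (G i) := fun i =>
    (EuclideanSpace.proj (𝕜 := ℝ) i).contDiff.comp hg
  have hGc : ∀ i, HasCompactSupport (G i) := fun i =>
    hgc.comp_left (g := fun v : Plane => v i) rfl
  have hg0 : ∀ x, x ∉ tsupport g → g x = 0 := fun x hx => image_eq_zero_of_notMem_tsupport hx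
  have hdiv0 : ∀ x, x ∉ tsupport g → divergence g x = 0 := fun x hx => by
    have : fderiv ℝ g x = 0 :=
      image_eq_zero_of_notMem_tsupport fun h => hx (tsupport_fderiv_subset ℝ h)
    simp [divergence, this]
  have hleft : ∫ x in Ω, f x * divergence g x =
      ∫ x, ∑ i, F x * fderiv ℝ (G i) x (EuclideanSpace.single i 1) := by
    rw [setIntegral_eq_integral_of_forall_compl_eq_zero fun x hx => by
      rw [hdiv0 x fun h => hx (hgs h), mul_zero]]
    refine integral_congr_ae (Eventually.of_forall fun x => ?_)
    simp only [G, ← Finset.mul_sum, ← divergence_eq_sum (hg.differentiable one_ne_zero)]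
    by_cases hx : x ∈ tsupport g
    · rw [hFf (interior_subset (hgK hx))]
    · simp [hdiv0 x hx]
  have hright : ∫ x in Ω, fderiv ℝ f x (g x) =
      ∫ x, ∑ i, lineDeriv ℝ F x (EuclideanSpace.single i 1) * G i x := by
    rw [setIntegral_eq_integral_of_forall_compl_eq_zero fun x hx => by
      rw [hg0 x fun h => hx (hgs h), map_zero]]
    refine integral_congr_ae ?_
    filter_upwards [hF.ae_differentiableAt] with x hx
    by_cases hxg : x ∈ tsupport g
    · have heq : f =ᶠ[𝓝 x] F := by
        filter_upwards [isOpen_interior.mem_nhds (hgK hxg)] with z hz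
          using hFf (interior_subset hz)
      have hv : g x = ∑ i : Fin 2, g x i • EuclideanSpace.single i (1 : ℝ) := by
        ext j
        fin_cases j <;> simp
      rw [heq.fderiv_eq]
      conv_lhs => rw [hv]
      simp [hx.lineDeriv_eq_fderiv, G, mul_comm]
    · simp [hg0 x hxg, G]
  rw [hleft, hright, integral_finsetSum, integral_finsetSum, ← Finset.sum_neg_distrib]
  · refine Finset.sum_congr rfl fun i _ => ?_
    obtain ⟨D, hD⟩ := ContDiff.lipschitzWith_of_hasCompactSupport (hGc i) (hGdiff i) one_ne_zero
    rw [hF.integral_lineDeriv_mul_eq hD (hGc i), ← integral_neg]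
    refine integral_congr_ae (Eventually.of_forall fun x => ?_)
    simp only
    rw [((hGdiff i).differentiable one_ne_zero x).lineDeriv_eq_fderiv, map_neg]
    ring
  · intro i _
    have := (hF.locallyIntegrable_lineDeriv (μ := volume)
      (EuclideanSpace.single i 1)).integrable_smul_left_of_hasCompactSupport
      (hGdiff i).continuous (hGc i)
    exact this.congr (Eventually.of_forall fun x => by simp [mul_comm])
  · intro i _
    refine Continuous.integrable_of_hasCompactSupport ?_ ?_
    · exact hF.continuous.mul
        (((hGdiff i).continuous_fderiv one_ne_zero).clm_apply continuous_const)
    · exact ((hGc i).fderiv_apply ℝ _).mul_left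

theorem setIntegral_mul_fderiv (hΩ : IsOpen Ω) {f : Plane → ℝ} (hf : LocallyLipschitzOn Ω f)
    {φ : Plane → ℝ} (hφ : ContDiff ℝ 1 φ) (hφc : HasCompactSupport φ) (hφs : tsupport φ ⊆ Ω)
    (v : Plane) : ∫ x in Ω, f x * fderiv ℝ φ x v = - ∫ x in Ω, fderiv ℝ f x v * φ x := by
  have hsupp : tsupport (fun x => φ x • v) ⊆ tsupport φ :=
    closure_mono fun x hx h0 => hx (by simp [h0])
  have h := setIntegral_mul_divergence hΩ hf (g := fun x => φ x • v) (hφ.smul contDiff_const)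
    (hφc.of_isClosed_subset (isClosed_tsupport _) hsupp) (hsupp.trans hφs)
  have hdiv : ∀ x, divergence (fun x => φ x • v) x = fderiv ℝ φ x v := fun x => by
    simpa using divergence_sum_smul (ι := Unit) (φ := fun _ => φ)
      (fun _ => hφ.differentiable one_ne_zero) (fun _ => v) x
  simpa [hdiv, mul_comm] using h

/-! ### The weak gradient -/

/-- A weak gradient of a function that is locally Lipschitz in the domain is its almost everywhere
defined gradient. -/
theorem IsH1WithGradient.ae_eq_gradient (hΩ : IsOpen Ω) (hb : Bornology.IsBounded Ω)
    {p : Plane → ℝ} {G : Plane → Plane} (hG : IsH1WithGradient Ω p G)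
    (hp : IsH1WithGradient Ω p (gradient p)) :
    ∀ᵐ x ∂volume.restrict Ω, G x = gradient p x := by
  have : IsFiniteMeasure (volume.restrict Ω : Measure Plane) := ⟨by simpa using hb.measure_lt_top⟩
  have hint1 : Integrable G (volume.restrict Ω) := hG.memLp_grad.integrable one_le_two
  have hint2 : Integrable (gradient p) (volume.restrict Ω) := hp.memLp_grad.integrable one_le_two
  have h0 : ∀ᵐ x ∂volume.restrict Ω, x ∈ Ω → G x - gradient p x = 0 := by
    refine hΩ.ae_eq_zero_of_integral_contDiff_smul_eq_zero
      ((hint1.sub hint2).locallyIntegrable.locallyIntegrableOn Ω) fun φ hφ hφc hφs => ?_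
    obtain ⟨C, hC⟩ := hφ.continuous.bounded_above_of_compact_support hφc
    have hi1 : Integrable (fun x => φ x • G x) (volume.restrict Ω) :=
      hint1.bdd_smul C hφ.continuous.aestronglyMeasurable (Eventually.of_forall hC)
    have hi2 : Integrable (fun x => φ x • gradient p x) (volume.restrict Ω) :=
      hint2.bdd_smul C hφ.continuous.aestronglyMeasurable (Eventually.of_forall hC)
    simp only [smul_sub]
    rw [integral_sub hi1 hi2, sub_eq_zero]
    refine ext_inner_right ℝ fun v => ?_
    rw [real_inner_comm, real_inner_comm v, ← integral_inner hi1, ← integral_inner hi2]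
    have h1 := hG.integral_eq φ hφ hφc hφs v
    rw [hp.integral_eq φ hφ hφc hφs v, neg_inj] at h1
    simpa only [real_inner_smul_right, mul_comm, real_inner_comm v] using h1.symm
  filter_upwards [h0, ae_restrict_mem hΩ.measurableSet] with x hx hxΩ
  exact sub_eq_zero.1 (hx hxΩ)

theorem measurable_gradient (p : Plane → ℝ) : Measurable (gradient p) :=
  (InnerProductSpace.toDual ℝ Plane).symm.continuous.measurable.comp (measurable_fderiv ℝ p)

/-! ### The sigmoidal profile -/

variable {ε : ℝ}

/-- The optimal-profile energy density `6 σ'(t)²`, where `σ' = σ (1 - σ)`. It is the derivative of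
`3 σ² - 2 σ³`, hence has integral one over the line. -/
noncomputable def profileDensity (t : ℝ) : ℝ := 6 * (t.sigmoid * (1 - t.sigmoid)) ^ 2

/-- The negative of the derivative of the profile density. -/
noncomputable def profileWeight (t : ℝ) : ℝ :=
  12 * (t.sigmoid * (1 - t.sigmoid)) ^ 2 * (2 * t.sigmoid - 1)

/-- The primitive `3 u² - 2 u³` of the double-well factor `6 u (1 - u)`; it maps `0` to `0` and `1`
to `1`. -/
noncomputable def wellPrimitive (u : ℝ) : ℝ := 3 * u ^ 2 - 2 * u ^ 3

theorem hasDerivAt_wellPrimitive (u : ℝ) : HasDerivAt wellPrimitive (6 * (u * (1 - u))) u := by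
  have := ((hasDerivAt_pow 2 u).const_mul 3).sub ((hasDerivAt_pow 3 u).const_mul 2)
  refine HasDerivAt.congr_deriv (f := wellPrimitive) this ?_
  push_cast
  ring

theorem hasDerivAt_wellPrimitive_sigmoid (t : ℝ) :
    HasDerivAt (fun t => wellPrimitive t.sigmoid) (profileDensity t) t := by
  refine ((hasDerivAt_wellPrimitive _).comp t (Real.hasDerivAt_sigmoid t)).congr_deriv ?_
  rw [profileDensity]
  ring

theorem hasDerivAt_profileDensity (t : ℝ) : HasDerivAt profileDensity (-profileWeight t) t := by
  have h := Real.hasDerivAt_sigmoid t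
  refine HasDerivAt.congr_deriv (f := profileDensity)
    (((h.mul (h.const_sub 1)).pow 2).const_mul 6) ?_
  rw [profileWeight]
  simp only [Pi.mul_apply]
  push_cast
  ring

theorem continuous_profileWeight : Continuous profileWeight := by
  have := continuous_sigmoid
  unfold profileWeight
  fun_prop

theorem sigmoid_mul_nonneg (t : ℝ) : 0 ≤ t.sigmoid * (1 - t.sigmoid) :=
  mul_nonneg t.sigmoid_nonneg (sub_nonneg.2 t.sigmoid_le_one)

theorem sigmoid_mul_le (t : ℝ) : t.sigmoid * (1 - t.sigmoid) ≤ 1 / 4 := by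
  nlinarith [sq_nonneg (t.sigmoid - 1 / 2)]

theorem profileDensity_nonneg (t : ℝ) : 0 ≤ profileDensity t := by
  unfold profileDensity
  positivity

theorem profileWeight_nonneg {t : ℝ} (ht : 0 ≤ t) : 0 ≤ profileWeight t := by
  have : 1 / 2 ≤ t.sigmoid := by
    have := Real.sigmoid_le ht
    rwa [Real.sigmoid_zero, ← one_div] at this
  unfold profileWeight
  exact mul_nonneg (by positivity) (by linarith)

theorem profileDensity_neg (t : ℝ) : profileDensity (-t) = profileDensity t := by
  rw [profileDensity, profileDensity, Real.sigmoid_neg]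
  ring

theorem profileDensity_le_exp {t : ℝ} : profileDensity t ≤ 6 * Real.exp (-t) := by
  have h1 : 1 - t.sigmoid ≤ Real.exp (-t) := by
    rw [← Real.sigmoid_neg, ← Real.sigmoid_mul_rexp_neg]
    exact mul_le_of_le_one_left (Real.exp_pos _).le t.sigmoid_le_one
  have h0 := sigmoid_mul_nonneg t
  have h2 : t.sigmoid * (1 - t.sigmoid) ≤ 1 - t.sigmoid :=
    mul_le_of_le_one_left (sub_nonneg.2 t.sigmoid_le_one) t.sigmoid_le_one
  unfold profileDensity
  nlinarith [sigmoid_mul_le t]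

theorem tendsto_mul_profileDensity :
    Tendsto (fun t => t * profileDensity t) atTop (𝓝 0) := by
  have h := (Real.tendsto_pow_mul_exp_neg_atTop_nhds_zero 1).const_mul 6
  rw [mul_zero] at h
  refine squeeze_zero' ?_ ?_ h
  · filter_upwards [eventually_ge_atTop 0] with t ht
    exact mul_nonneg ht (profileDensity_nonneg t)
  · filter_upwards [eventually_ge_atTop 0] with t ht
    have := mul_le_mul_of_nonneg_left (profileDensity_le_exp (t := t)) ht
    linarith

theorem tendsto_profileDensity : Tendsto profileDensity atTop (𝓝 0) := by
  refine squeeze_zero' (Eventually.of_forall profileDensity_nonneg) ?_ tendsto_mul_profileDensity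
  filter_upwards [eventually_ge_atTop 1] with t ht
  exact le_mul_of_one_le_left (profileDensity_nonneg t) ht

/-- The profile density is the tail integral of its weight. -/
theorem lintegral_profileWeight_Ioi {t : ℝ} (ht : 0 ≤ t) :
    ∫⁻ s in Ioi t, ENNReal.ofReal (profileWeight s) = ENNReal.ofReal (profileDensity t) := by
  have hd : ∀ s ∈ Ici t, HasDerivAt (fun s => - profileDensity s) (profileWeight s) s :=
    fun s _ => (hasDerivAt_profileDensity s).neg.congr_deriv (neg_neg _)
  have h0 : ∀ s ∈ Ioi t, 0 ≤ profileWeight s := fun s hs =>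
    profileWeight_nonneg (ht.trans (le_of_lt hs))
  have hl : Tendsto (fun s => - profileDensity s) atTop (𝓝 0) := by
    simpa using tendsto_profileDensity.neg
  rw [← ofReal_integral_eq_lintegral_ofReal (integrableOn_Ioi_deriv_of_nonneg' hd h0 hl)
    ((ae_restrict_iff' measurableSet_Ioi).2 (Eventually.of_forall h0)),
    integral_Ioi_of_hasDerivAt_of_nonneg' hd h0 hl]
  simp

/-- The first moment of the weight: the total energy of the profile across the boundary, both sides
together, is one. -/
theorem lintegral_mul_profileWeight :
    ∫⁻ s in Ioi (0 : ℝ), ENNReal.ofReal (2 * s) * ENNReal.ofReal (profileWeight s) = 1 := by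
  have hd : ∀ s ∈ Ici (0 : ℝ), HasDerivAt
      (fun s => 2 * wellPrimitive s.sigmoid - 2 * (s * profileDensity s))
      (2 * s * profileWeight s) s := fun s _ => by
    refine (((hasDerivAt_wellPrimitive_sigmoid s).const_mul 2).sub
      (((hasDerivAt_id s).mul (hasDerivAt_profileDensity s)).const_mul 2)).congr_deriv ?_
    simp only [id]
    ring
  have h0 : ∀ s ∈ Ioi (0 : ℝ), 0 ≤ 2 * s * profileWeight s := fun s hs =>
    mul_nonneg (by linarith [mem_Ioi.1 hs]) (profileWeight_nonneg (le_of_lt hs))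
  have hl : Tendsto (fun s : ℝ => 2 * wellPrimitive s.sigmoid - 2 * (s * profileDensity s)) atTop
      (𝓝 2) := by
    have h1 : Tendsto (fun s : ℝ => wellPrimitive s.sigmoid) atTop (𝓝 (wellPrimitive 1)) :=
      (hasDerivAt_wellPrimitive 1).continuousAt.tendsto.comp Real.tendsto_sigmoid_atTop
    have h2 := (h1.const_mul 2).sub (tendsto_mul_profileDensity.const_mul 2)
    convert h2 using 2
    norm_num [wellPrimitive]
  have heq : ∀ s ∈ Ioi (0 : ℝ), ENNReal.ofReal (2 * s) * ENNReal.ofReal (profileWeight s) =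
      ENNReal.ofReal (2 * s * profileWeight s) := fun s hs =>
    (ENNReal.ofReal_mul (by linarith [mem_Ioi.1 hs])).symm
  rw [setLIntegral_congr_fun measurableSet_Ioi heq,
    ← ofReal_integral_eq_lintegral_ofReal (integrableOn_Ioi_deriv_of_nonneg' hd h0 hl)
    ((ae_restrict_iff' measurableSet_Ioi).2 (Eventually.of_forall h0)),
    integral_Ioi_of_hasDerivAt_of_nonneg' hd h0 hl]
  norm_num [wellPrimitive, Real.sigmoid_zero]

theorem lipschitzWith_comp_div {f : ℝ → ℝ} (hf : LipschitzWith 1 f) (c : ℝ) :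
    LipschitzWith ‖c⁻¹‖₊ fun t => f (t / c) := by
  have h := hf.comp (lipschitzWith_smul (α := ℝ) (β := ℝ) c⁻¹)
  rw [one_mul] at h
  simpa only [Function.comp_def, smul_eq_mul, ← div_eq_inv_mul] using h

theorem lipschitzWith_sigmoid : LipschitzWith 1 Real.sigmoid := by
  refine lipschitzWith_of_nnnorm_deriv_le differentiable_sigmoid fun t => ?_
  rw [(Real.hasDerivAt_sigmoid t).deriv, ← NNReal.coe_le_coe, coe_nnnorm,
    Real.norm_of_nonneg (sigmoid_mul_nonneg t)]
  exact (sigmoid_mul_le t).trans (by norm_num)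

theorem lipschitzWith_wellPrimitive_sigmoid :
    LipschitzWith 1 fun t : ℝ => wellPrimitive t.sigmoid := by
  refine lipschitzWith_of_nnnorm_deriv_le
    (fun t => (hasDerivAt_wellPrimitive_sigmoid t).differentiableAt) fun t => ?_
  rw [(hasDerivAt_wellPrimitive_sigmoid t).deriv, ← NNReal.coe_le_coe, coe_nnnorm,
    Real.norm_of_nonneg (profileDensity_nonneg t), profileDensity, NNReal.coe_one]
  nlinarith [sigmoid_mul_le t, sigmoid_mul_nonneg t]

theorem locallyLipschitzOn_sigmoidProfile (hΩ : IsOpen Ω) :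
    LocallyLipschitzOn Ω (sigmoidProfile Ω V ε) :=
  locallyLipschitzOn_comp_signedDistance hΩ (lipschitzWith_comp_div lipschitzWith_sigmoid _)

theorem locallyLipschitzOn_wellPrimitive (hΩ : IsOpen Ω) :
    LocallyLipschitzOn Ω fun x => wellPrimitive (sigmoidProfile Ω V ε x) :=
  locallyLipschitzOn_comp_signedDistance hΩ
    (lipschitzWith_comp_div lipschitzWith_wellPrimitive_sigmoid _)

theorem norm_gradient_eq (p : Plane → ℝ) (x : Plane) : ‖gradient p x‖ = ‖fderiv ℝ p x‖ := by
  rw [← toDual_gradient, LinearIsometryEquiv.norm_map]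

theorem sigmoidProfile_mul_nonneg (x : Plane) :
    0 ≤ sigmoidProfile Ω V ε x * (1 - sigmoidProfile Ω V ε x) := sigmoid_mul_nonneg _

/-- The chain rule for the profile, almost everywhere in the domain. The first inequality becomes
an equality where the distance has slope one; only the inequality is needed. -/
theorem ae_gradient_sigmoidProfile (hΩ : IsOpen Ω) (hε : 0 < ε) : ∀ᵐ x ∂volume.restrict Ω,
    ‖gradient (sigmoidProfile Ω V ε) x‖ ≤
      sigmoidProfile Ω V ε x * (1 - sigmoidProfile Ω V ε x) / (3 * ε) ∧
    fderiv ℝ (fun x => wellPrimitive (sigmoidProfile Ω V ε x)) x =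
      (6 * (sigmoidProfile Ω V ε x * (1 - sigmoidProfile Ω V ε x))) •
        fderiv ℝ (sigmoidProfile Ω V ε) x := by
  filter_upwards [ae_hasFDerivAt_signedDistance (V := V) hΩ] with x hx
  obtain ⟨L, hL, hL1⟩ := hx
  set d := signedDistance Ω V
  have h1 : HasDerivAt (fun t : ℝ => (t / (3 * ε)).sigmoid)
      (sigmoidProfile Ω V ε x * (1 - sigmoidProfile Ω V ε x) * (1 / (3 * ε))) (d x) :=
    (Real.hasDerivAt_sigmoid _).comp (d x) ((hasDerivAt_id (d x)).div_const (3 * ε))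
  have h2 : HasFDerivAt (sigmoidProfile Ω V ε)
      ((sigmoidProfile Ω V ε x * (1 - sigmoidProfile Ω V ε x) * (1 / (3 * ε))) • L) x :=
    h1.comp_hasFDerivAt x hL
  refine ⟨?_, ?_⟩
  · have h0 := sigmoidProfile_mul_nonneg (Ω := Ω) (V := V) (ε := ε) x
    rw [norm_gradient_eq, h2.fderiv, norm_smul, Real.norm_of_nonneg (by positivity),
      mul_one_div]
    exact mul_le_of_le_one_right (by positivity) hL1
  · exact ((hasDerivAt_wellPrimitive _).comp_hasFDerivAt x h2.differentiableAt.hasFDerivAt).fderiv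

theorem isH1WithGradient_sigmoidProfile (hΩ : IsOpen Ω) (hb : Bornology.IsBounded Ω)
    (hε : 0 < ε) :
    IsH1WithGradient Ω (sigmoidProfile Ω V ε) (gradient (sigmoidProfile Ω V ε)) := by
  have : IsFiniteMeasure (volume.restrict Ω : Measure Plane) := ⟨by simpa using hb.measure_lt_top⟩
  have hlip := locallyLipschitzOn_sigmoidProfile (V := V) (ε := ε) hΩ
  refine ⟨?_, ?_, fun φ hφ hφc hφs v => ?_⟩
  · refine MemLp.of_bound (hlip.continuousOn.aestronglyMeasurable hΩ.measurableSet) 1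
      (Eventually.of_forall fun x => ?_)
    rw [sigmoidProfile, Real.norm_of_nonneg (Real.sigmoid_nonneg _)]
    exact Real.sigmoid_le_one _
  · refine MemLp.of_bound (measurable_gradient _).aestronglyMeasurable (1 / (3 * ε)) ?_
    filter_upwards [ae_gradient_sigmoidProfile (V := V) hΩ hε] with x hx
    refine hx.1.trans ?_
    gcongr
    exact (sigmoid_mul_le _).trans (by norm_num)
  · simp only [inner_gradient_left]
    exact setIntegral_mul_fderiv hΩ hlip (hφ.of_le (by exact_mod_cast le_top)) hφc hφs v

/-! ### Bounds for the energy -/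

/-- The energy of the profile is at most the integral of the profile density of the distance,
because the gradient term does not exceed the potential term. -/
theorem energy_sigmoidProfile_le (hΩ : IsOpen Ω) (hb : Bornology.IsBounded Ω) (hε : 0 < ε) :
    energy Ω ε (sigmoidProfile Ω V ε) ≤ (ENNReal.ofReal (3 * ε))⁻¹ *
      ∫⁻ x in Ω, ENNReal.ofReal
        (profileDensity (Metric.infDist x (hardBoundary Ω V) / (3 * ε))) := by
  refine (iInf₂_le _ (isH1WithGradient_sigmoidProfile hΩ hb hε)).trans ?_
  rw [← lintegral_const_mul' _ _ (by simp [hε])]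
  refine lintegral_mono_ae ?_
  filter_upwards [ae_gradient_sigmoidProfile (V := V) hΩ hε] with x hx
  have h0 := sigmoidProfile_mul_nonneg (Ω := Ω) (V := V) (ε := ε) x
  have hF : profileDensity (Metric.infDist x (hardBoundary Ω V) / (3 * ε)) =
      6 * (sigmoidProfile Ω V ε x * (1 - sigmoidProfile Ω V ε x)) ^ 2 := by
    change _ = profileDensity (signedDistance Ω V x / (3 * ε))
    rw [signedDistance]
    split_ifs
    · rfl
    · rw [neg_div, profileDensity_neg]
  rw [hF, ← ENNReal.ofReal_inv_of_pos (by linarith), ← ENNReal.ofReal_mul (by positivity)]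
  refine ENNReal.ofReal_le_ofReal ?_
  have h1 : ‖gradient (sigmoidProfile Ω V ε) x‖ ^ 2 ≤
      (sigmoidProfile Ω V ε x * (1 - sigmoidProfile Ω V ε x) / (3 * ε)) ^ 2 :=
    pow_le_pow_left₀ (norm_nonneg _) hx.1 2
  calc _ ≤ 9 * ε * (sigmoidProfile Ω V ε x * (1 - sigmoidProfile Ω V ε x) / (3 * ε)) ^ 2 +
        (sigmoidProfile Ω V ε x * (1 - sigmoidProfile Ω V ε x)) ^ 2 / ε := by gcongr
    _ = _ := by
      field_simp
      ring

/-- The layer-cake formula for the profile density of the distance. -/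
theorem lintegral_profileDensity_infDist (hε : 0 < ε) :
    ∫⁻ x in Ω, ENNReal.ofReal (profileDensity (Metric.infDist x (hardBoundary Ω V) / (3 * ε))) =
      ∫⁻ s in Ioi 0, ENNReal.ofReal (profileWeight s) *
        volume (Ω ∩ {x | Metric.infDist x (hardBoundary Ω V) < s * (3 * ε)}) := by
  set D : Plane → ℝ := fun x => Metric.infDist x (hardBoundary Ω V)
  have hD : Continuous D := Metric.continuous_infDist_pt _
  let E : Set (Plane × ℝ) := {q | D q.1 / (3 * ε) < q.2}
  have hE : MeasurableSet E := measurableSet_lt (by fun_prop) (by fun_prop)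
  have hw : Measurable fun s => ENNReal.ofReal (profileWeight s) :=
    continuous_profileWeight.measurable.ennreal_ofReal
  calc _ = ∫⁻ x in Ω, ∫⁻ s in Ioi 0,
        E.indicator (fun q => ENNReal.ofReal (profileWeight q.2)) (x, s) := by
        refine lintegral_congr fun x => ?_
        have h0 : 0 ≤ D x / (3 * ε) := div_nonneg Metric.infDist_nonneg (by linarith)
        rw [← lintegral_profileWeight_Ioi h0, ← lintegral_indicator measurableSet_Ioi,
          ← lintegral_indicator measurableSet_Ioi]
        refine lintegral_congr fun s => ?_
        by_cases hs : D x / (3 * ε) < s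
        · have h1 : (x, s) ∈ E := hs
          rw [indicator_of_mem (mem_Ioi.2 hs), indicator_of_mem (mem_Ioi.2 (h0.trans_lt hs)),
            indicator_of_mem h1]
        · have h1 : (x, s) ∉ E := hs
          have h2 : s ∉ Ioi (D x / (3 * ε)) := hs
          classical
          rw [indicator_of_notMem h2, indicator_apply, indicator_of_notMem h1, ite_self]
    _ = ∫⁻ s in Ioi 0, ∫⁻ x in Ω,
        E.indicator (fun q => ENNReal.ofReal (profileWeight q.2)) (x, s) :=
        lintegral_lintegral_swap ((hw.comp measurable_snd).indicator hE).aemeasurable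
    _ = _ := by
        refine lintegral_congr fun s => ?_
        have hm : MeasurableSet {x | D x < s * (3 * ε)} :=
          measurableSet_lt (by fun_prop) (by fun_prop)
        have : (fun x => E.indicator (fun q => ENNReal.ofReal (profileWeight q.2)) (x, s)) =
            {x | D x < s * (3 * ε)}.indicator fun _ => ENNReal.ofReal (profileWeight s) := by
          classical
          ext x
          simp only [indicator_apply, E, mem_ofPred_eq, div_lt_iff₀ (by linarith : 0 < 3 * ε)]
        rw [this, lintegral_indicator_const hm, Measure.restrict_apply hm, inter_comm]

/-- The upper bound for the energy. In the layer-cake formula the volume of the tube of radius `r`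
is at most `2 r c` for small `r` and at most `2 r C` for all `r`. -/
theorem eventually_energy_lt (hΩ : IsOpen Ω) (hb : Bornology.IsBounded Ω)
    (hΓ : (hardBoundary Ω V).Nonempty) (hreg : HasRegularBoundary Ω V) {c : ℝ≥0∞}
    (hc : μH[1] (hardBoundary Ω V) < c) :
    ∀ᶠ ε in 𝓝[>] (0 : ℝ), energy Ω ε (sigmoidProfile Ω V ε) < c := by
  obtain ⟨c', hc', hc'c⟩ := exists_between hc
  rw [← hreg.hausdorffMeasure_closure hΩ] at hc'
  obtain ⟨r₀, hr₀, hsmall⟩ := mem_nhdsGT_iff_exists_Ioo_subset.1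
    (eventually_volume_thickening_le hΩ hb hreg hc')
  have hr₀' : (0 : ℝ) < r₀ := hr₀
  set C : ℝ≥0∞ := c' + volume Ω / ENNReal.ofReal (2 * r₀)
  have hC : C ≠ ⊤ := ENNReal.add_ne_top.2
    ⟨hc'c.ne_top, ENNReal.div_ne_top hb.measure_lt_top.ne (by simp [hr₀'])⟩
  set b : ℝ → ℝ≥0∞ := fun r => if r < r₀ then c' else C
  have hvol : ∀ r > 0, volume (Ω ∩ {x | Metric.infDist x (hardBoundary Ω V) < r}) ≤
      ENNReal.ofReal (2 * r) * b r := by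
    intro r hr
    by_cases hrr : r < r₀
    · simp only [b, if_pos hrr]
      refine (measure_mono ?_).trans (hsmall ⟨hr, hrr⟩)
      rintro x ⟨-, hx⟩
      rw [Metric.thickening_closure]
      exact Metric.mem_thickening_iff.2 ((Metric.infDist_lt_iff hΓ).1 hx)
    · simp only [b, if_neg hrr]
      rw [not_lt] at hrr
      calc _ ≤ volume Ω := measure_mono inter_subset_left
        _ = ENNReal.ofReal (2 * r₀) * (volume Ω / ENNReal.ofReal (2 * r₀)) :=
          (ENNReal.mul_div_cancel (by simp [hr₀']) ENNReal.ofReal_ne_top).symm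
        _ ≤ _ := by
          gcongr
          exact le_add_self
  have hb' : Measurable b := Measurable.ite measurableSet_Iio measurable_const measurable_const
  let F : ℝ → ℝ → ℝ≥0∞ := fun ε s =>
    ENNReal.ofReal (2 * s) * ENNReal.ofReal (profileWeight s) * b (s * (3 * ε))
  have hbound : ∀ ε > 0, energy Ω ε (sigmoidProfile Ω V ε) ≤ ∫⁻ s in Ioi 0, F ε s := by
    intro ε hε
    refine (energy_sigmoidProfile_le hΩ hb hε).trans ?_
    rw [lintegral_profileDensity_infDist hε, ← lintegral_const_mul' _ _ (by simp [hε])]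
    refine setLIntegral_mono' measurableSet_Ioi fun s hs => ?_
    have hs0 : (0 : ℝ) < s := hs
    have e : ENNReal.ofReal (2 * (s * (3 * ε))) =
        ENNReal.ofReal (2 * s) * ENNReal.ofReal (3 * ε) := by
      rw [← ENNReal.ofReal_mul (by linarith)]
      congr 1
      ring
    calc _ ≤ (ENNReal.ofReal (3 * ε))⁻¹ * (ENNReal.ofReal (profileWeight s) *
          (ENNReal.ofReal (2 * (s * (3 * ε))) * b (s * (3 * ε)))) := by
          gcongr
          exact hvol _ (by positivity)
      _ = ((ENNReal.ofReal (3 * ε))⁻¹ * ENNReal.ofReal (3 * ε)) * F ε s := by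
          rw [e]
          ring
      _ = F ε s := by
          rw [ENNReal.inv_mul_cancel (by simp [hε]) ENNReal.ofReal_ne_top, one_mul]
  have hwm : Measurable fun s => ENNReal.ofReal (2 * s) * ENNReal.ofReal (profileWeight s) :=
    (measurable_const.mul measurable_id).ennreal_ofReal.mul
      continuous_profileWeight.measurable.ennreal_ofReal
  have hlim : Tendsto (fun ε => ∫⁻ s in Ioi 0, F ε s) (𝓝[>] 0) (𝓝 c') := by
    have h1 : ∫⁻ s in Ioi (0 : ℝ),
        ENNReal.ofReal (2 * s) * ENNReal.ofReal (profileWeight s) * c' = c' := by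
      rw [lintegral_mul_const _ hwm, lintegral_mul_profileWeight, one_mul]
    have h2 : Tendsto (fun ε => ∫⁻ s in Ioi 0, F ε s) (𝓝[>] 0) (𝓝 (∫⁻ s in Ioi (0 : ℝ),
        ENNReal.ofReal (2 * s) * ENNReal.ofReal (profileWeight s) * c')) := by
      refine tendsto_lintegral_filter_of_dominated_convergence
        (fun s => ENNReal.ofReal (2 * s) * ENNReal.ofReal (profileWeight s) * C) ?_ ?_ ?_ ?_
      · exact Eventually.of_forall fun ε => hwm.mul (hb'.comp (by fun_prop))
      · refine Eventually.of_forall fun ε => Eventually.of_forall fun s => ?_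
        simp only [F, b]
        gcongr
        split_ifs
        · exact le_self_add
        · exact le_rfl
      · rw [lintegral_mul_const _ hwm, lintegral_mul_profileWeight, one_mul]
        exact hC
      · refine Eventually.of_forall fun s => tendsto_const_nhds.congr' ?_
        have h3 : Tendsto (fun ε : ℝ => s * (3 * ε)) (𝓝[>] 0) (𝓝 0) := by
          have : Continuous fun ε : ℝ => s * (3 * ε) := by fun_prop
          simpa using (this.tendsto 0).mono_left nhdsWithin_le_nhds
        filter_upwards [h3.eventually_lt_const hr₀'] with ε hε
        simp only [F, b, if_pos hε]
    rwa [h1] at h2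
  filter_upwards [hlim.eventually_lt_const hc'c, self_mem_nhdsWithin] with ε hε hε0
  exact (hbound ε hε0).trans_lt hε

/-- The lower bound for the energy, by the inequality of Modica and Mortola: the energy dominates
the variation of the primitive of the double-well factor. -/
theorem ofReal_setIntegral_le_energy (hΩ : IsOpen Ω) (hb : Bornology.IsBounded Ω) (hε : 0 < ε)
    {g : Plane → Plane} (hg : ContDiff ℝ 1 g) (hgc : HasCompactSupport g) (hgs : tsupport g ⊆ Ω)
    (hg1 : ∀ x, ‖g x‖ ≤ 1) :
    ENNReal.ofReal (∫ x in Ω, wellPrimitive (sigmoidProfile Ω V ε x) * divergence g x) ≤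
      energy Ω ε (sigmoidProfile Ω V ε) := by
  refine le_iInf₂ fun G hG => ?_
  rw [setIntegral_mul_divergence hΩ (locallyLipschitzOn_wellPrimitive hΩ) hg hgc hgs,
    ← integral_neg]
  refine (Real.ofReal_le_enorm _).trans ((enorm_integral_le_lintegral_enorm _).trans ?_)
  refine lintegral_mono_ae ?_
  filter_upwards [ae_gradient_sigmoidProfile (V := V) hΩ hε,
    hG.ae_eq_gradient hΩ hb (isH1WithGradient_sigmoidProfile hΩ hb hε)] with x hx hGx
  have h0 := sigmoidProfile_mul_nonneg (Ω := Ω) (V := V) (ε := ε) x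
  set q := sigmoidProfile Ω V ε x * (1 - sigmoidProfile Ω V ε x)
  rw [enorm_neg, hx.2, ← ofReal_norm]
  refine ENNReal.ofReal_le_ofReal ?_
  rw [hGx, ← sub_nonneg]
  set m := ‖gradient (sigmoidProfile Ω V ε) x‖ with hm
  have h1 : ‖((6 * q) • fderiv ℝ (sigmoidProfile Ω V ε) x) (g x)‖ ≤ 6 * q * m := by
    calc _ ≤ ‖(6 * q) • fderiv ℝ (sigmoidProfile Ω V ε) x‖ * ‖g x‖ :=
          ContinuousLinearMap.le_opNorm _ _
      _ ≤ ‖(6 * q) • fderiv ℝ (sigmoidProfile Ω V ε) x‖ :=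
          mul_le_of_le_one_right (norm_nonneg _) (hg1 x)
      _ = _ := by rw [norm_smul, Real.norm_of_nonneg (by positivity), hm, norm_gradient_eq]
  -- Young's inequality, as a completed square
  have h2 : 9 * ε * m ^ 2 + q ^ 2 / ε - 6 * q * m = (3 * ε * m - q) ^ 2 / ε := by
    field_simp
    ring
  have h3 : 0 ≤ (3 * ε * m - q) ^ 2 / ε := by positivity
  linarith

/-! ### Convergence of the profiles -/

theorem ae_tendsto_sigmoidProfile (hΩ : IsOpen Ω) (hb : Bornology.IsBounded Ω)
    (hΓ : (hardBoundary Ω V).Nonempty) (hreg : HasRegularBoundary Ω V) :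
    ∀ᵐ x, Tendsto (fun ε => sigmoidProfile Ω V ε x) (𝓝[>] 0)
      (𝓝 (V.indicator (fun _ => (1 : ℝ)) x)) := by
  filter_upwards [measure_eq_zero_iff_ae_notMem.1 (hreg.volume_closure_eq_zero hΩ hb)] with x hx
  have hpos : 0 < Metric.infDist x (hardBoundary Ω V) := by
    exact (Metric.infDist_pos_iff_notMem_closure hΓ).1 hx
  have hinv : Tendsto (fun ε : ℝ => (3 * ε)⁻¹) (𝓝[>] 0) atTop := by
    refine tendsto_inv_nhdsGT_zero.comp (tendsto_nhdsWithin_iff.2 ⟨?_, ?_⟩)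
    · have : Continuous fun ε : ℝ => 3 * ε := by fun_prop
      simpa using (this.tendsto 0).mono_left nhdsWithin_le_nhds
    · filter_upwards [self_mem_nhdsWithin] with ε hε
      exact mul_pos three_pos (mem_Ioi.1 hε)
  simp only [sigmoidProfile, signedDistance, div_eq_mul_inv]
  by_cases hxV : x ∈ V
  · simp only [if_pos hxV, indicator_of_mem hxV]
    exact Real.tendsto_sigmoid_atTop.comp (hinv.const_mul_atTop hpos)
  · simp only [if_neg hxV, indicator_of_notMem hxV]
    exact Real.tendsto_sigmoid_atBot.comp (hinv.const_mul_atTop_of_neg (neg_neg_of_pos hpos))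

theorem tendsto_eLpNorm_sigmoidProfile (hΩ : IsOpen Ω) (hb : Bornology.IsBounded Ω) (hV : V ⊆ Ω)
    (hΓ : (hardBoundary Ω V).Nonempty) (hreg : HasRegularBoundary Ω V) :
    Tendsto (fun ε : ℝ => eLpNorm
      (fun x => sigmoidProfile Ω V ε x - V.indicator (fun _ => (1 : ℝ)) x) 1 (volume.restrict Ω))
      (𝓝[>] 0) (𝓝 0) := by
  have : IsFiniteMeasure (volume.restrict Ω : Measure Plane) := ⟨by simpa using hb.measure_lt_top⟩
  have hmeas : ∀ ε, AEStronglyMeasurable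
      (fun x => sigmoidProfile Ω V ε x - V.indicator (fun _ => (1 : ℝ)) x)
      (volume.restrict Ω) := fun ε =>
    ((locallyLipschitzOn_sigmoidProfile hΩ).continuousOn.aestronglyMeasurable
      hΩ.measurableSet).sub ((aestronglyMeasurable_const.indicator₀
        (hreg.nullMeasurableSet hΩ hb hV)).restrict)
  have hle : ∀ ε x, ‖sigmoidProfile Ω V ε x - V.indicator (fun _ => (1 : ℝ)) x‖ ≤ 1 := by
    intro ε x
    have h1 : 0 ≤ sigmoidProfile Ω V ε x := Real.sigmoid_nonneg _
    have h2 : sigmoidProfile Ω V ε x ≤ 1 := Real.sigmoid_le_one _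
    rw [Real.norm_eq_abs, abs_le]
    by_cases hx : x ∈ V
    · rw [indicator_of_mem hx]
      constructor <;> linarith
    · rw [indicator_of_notMem hx]
      constructor <;> linarith
  have hlim : Tendsto (fun ε => ∫ x in Ω,
      ‖sigmoidProfile Ω V ε x - V.indicator (fun _ => (1 : ℝ)) x‖) (𝓝[>] 0)
      (𝓝 (∫ _ in Ω, (0 : ℝ))) := by
    refine tendsto_integral_filter_of_dominated_convergence (fun _ => 1)
      (Eventually.of_forall fun ε => (hmeas ε).norm)
      (Eventually.of_forall fun ε => Eventually.of_forall fun x => ?_) (integrable_const _) ?_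
    · rw [norm_norm]
      exact hle ε x
    · filter_upwards [ae_restrict_of_ae (ae_tendsto_sigmoidProfile hΩ hb hΓ hreg)] with x hx
      simpa using (hx.sub_const (V.indicator (fun _ => (1 : ℝ)) x)).norm
  rw [integral_zero] at hlim
  have := (ENNReal.continuous_ofReal.tendsto 0).comp hlim
  rw [ENNReal.ofReal_zero] at this
  refine this.congr fun ε => ?_
  rw [eLpNorm_one_eq_lintegral_enorm, Function.comp_apply, ofReal_integral_norm_eq_lintegral_enorm]
  exact Integrable.of_bound (hmeas ε) 1 (Eventually.of_forall (hle ε))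

/-- Lower semicontinuity: the energies eventually exceed everything below the total variation. -/
theorem eventually_lt_energy (hΩ : IsOpen Ω) (hb : Bornology.IsBounded Ω)
    (hΓ : (hardBoundary Ω V).Nonempty) (hreg : HasRegularBoundary Ω V) {c : ℝ≥0∞}
    (hc : c < totalVariation Ω (V.indicator fun _ => (1 : ℝ))) :
    ∀ᶠ ε in 𝓝[>] (0 : ℝ), c < energy Ω ε (sigmoidProfile Ω V ε) := by
  simp only [totalVariation, lt_iSup_iff] at hc
  obtain ⟨g, ⟨hg, hgc, hgs, hg1⟩, hcg⟩ := hc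
  have hdiv : Continuous (divergence g) := by
    refine continuous_finsetSum _ fun i _ => ?_
    exact (EuclideanSpace.proj (𝕜 := ℝ) i).continuous.comp
      ((hg.continuous_fderiv one_ne_zero).clm_apply continuous_const)
  have hdivc : HasCompactSupport (divergence g) := by
    refine HasCompactSupport.intro (hgc.fderiv ℝ).isCompact fun x hx => ?_
    simp [divergence, image_eq_zero_of_notMem_tsupport hx]
  have hQ : Continuous wellPrimitive := by
    unfold wellPrimitive
    fun_prop
  have hlim : Tendsto (fun ε => ∫ x in Ω,
      wellPrimitive (sigmoidProfile Ω V ε x) * divergence g x) (𝓝[>] 0)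
      (𝓝 (∫ x in Ω, V.indicator (fun _ => (1 : ℝ)) x * divergence g x)) := by
    refine tendsto_integral_filter_of_dominated_convergence (fun x => ‖divergence g x‖)
      (Eventually.of_forall fun ε => ?_)
      (Eventually.of_forall fun ε => Eventually.of_forall fun x => ?_)
      (hdiv.integrable_of_hasCompactSupport hdivc).norm.restrict ?_
    · exact ((locallyLipschitzOn_wellPrimitive hΩ).continuousOn.aestronglyMeasurable
        hΩ.measurableSet).mul hdiv.aestronglyMeasurable
    · rw [norm_mul]
      refine mul_le_of_le_one_left (norm_nonneg _) ?_
      have h1 : 0 ≤ sigmoidProfile Ω V ε x := Real.sigmoid_nonneg _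
      have h2 : sigmoidProfile Ω V ε x ≤ 1 := Real.sigmoid_le_one _
      rw [Real.norm_eq_abs, abs_le, wellPrimitive]
      set u := sigmoidProfile Ω V ε x
      have h3 : 3 * u ^ 2 - 2 * u ^ 3 = u ^ 2 * (3 - 2 * u) := by ring
      have h4 : 1 - (3 * u ^ 2 - 2 * u ^ 3) = (1 - u) ^ 2 * (1 + 2 * u) := by ring
      have h5 : 0 ≤ u ^ 2 * (3 - 2 * u) := mul_nonneg (sq_nonneg _) (by linarith)
      have h6 : 0 ≤ (1 - u) ^ 2 * (1 + 2 * u) := by positivity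
      constructor <;> linarith
    · filter_upwards [ae_restrict_of_ae (ae_tendsto_sigmoidProfile hΩ hb hΓ hreg)] with x hx
      have hfix : wellPrimitive (V.indicator (fun _ => (1 : ℝ)) x) =
          V.indicator (fun _ => (1 : ℝ)) x := by
        by_cases hxV : x ∈ V
        · rw [indicator_of_mem hxV, wellPrimitive]
          norm_num
        · rw [indicator_of_notMem hxV, wellPrimitive]
          norm_num
      have := ((hQ.tendsto _).comp hx).mul_const (divergence g x)
      rwa [hfix] at this
  have hlim' := (ENNReal.continuous_ofReal.tendsto _).comp hlim
  filter_upwards [hlim'.eventually_const_lt hcg, self_mem_nhdsWithin] with ε hε hε0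
  exact hε.trans_le (ofReal_setIntegral_le_energy hΩ hb hε0 hg hgc hgs hg1)

end SoftMS

theorem proposition3p1 (Ω : Set SoftMS.Plane) (hΩ_open : IsOpen Ω)
    (hΩ_bdd : Bornology.IsBounded Ω)
    (V : Set SoftMS.Plane) (hV : V ⊆ Ω)
    (hΓ_nonempty : (SoftMS.hardBoundary Ω V).Nonempty)
    (hΓ_regular : SoftMS.HasRegularBoundary Ω V) :
    Tendsto (fun ε : ℝ => eLpNorm
        (fun x => SoftMS.sigmoidProfile Ω V ε x - V.indicator (fun _ => (1 : ℝ)) x)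
        1 (volume.restrict Ω)) (𝓝[>] 0) (𝓝 0) ∧
    Tendsto (fun ε : ℝ => SoftMS.energy Ω ε (SoftMS.sigmoidProfile Ω V ε)) (𝓝[>] 0)
      (𝓝 (μH[1] (SoftMS.hardBoundary Ω V))) ∧
    μH[1] (SoftMS.hardBoundary Ω V) =
      SoftMS.totalVariation Ω (V.indicator (fun _ => (1 : ℝ))) ∧
    μH[1] (SoftMS.hardBoundary Ω V) < ⊤ := by
  have hTV := SoftMS.hausdorffMeasure_hardBoundary_le_totalVariation hΩ_open hΩ_bdd hV hΓ_regular
  refine ⟨SoftMS.tendsto_eLpNorm_sigmoidProfile hΩ_open hΩ_bdd hV hΓ_nonempty hΓ_regular,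
    tendsto_order.2 ⟨fun c hc => ?_, fun c hc => ?_⟩, le_antisymm hTV ?_, ?_⟩
  · exact SoftMS.eventually_lt_energy hΩ_open hΩ_bdd hΓ_nonempty hΓ_regular (hc.trans_le hTV)
  · exact SoftMS.eventually_energy_lt hΩ_open hΩ_bdd hΓ_nonempty hΓ_regular hc
  · by_contra! hlt
    obtain ⟨c, hc1, hc2⟩ := exists_between hlt
    obtain ⟨ε, h1, h2⟩ :=
      ((SoftMS.eventually_energy_lt hΩ_open hΩ_bdd hΓ_nonempty hΓ_regular hc1).and
        (SoftMS.eventually_lt_energy hΩ_open hΩ_bdd hΓ_nonempty hΓ_regular hc2)).exists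
    exact absurd h1 h2.not_gt
  · exact (measure_mono subset_closure).trans_lt
      (SoftMS.hausdorffMeasure_closure_hardBoundary_lt_top hΩ_open hΩ_bdd hΓ_regular)
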